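/- Let $\mathrm{Cob}(n)$ be Bar-Natan's dotted cobordism category over $\mathbb Z[\alpha]$. Its objects are formally $q$-graded crossingless (Temperley–Lieb) diagrams $q^iA$ in the disk with $2n$ boundary points, circles allowed. Its morphisms are $\mathbb Z[\alpha]$-linear combinations of dotted orientable cobordisms, modulo the relations: a sphere with $0,1,2,3$ dots equals $0,1,0,\alpha$, and a neck may be cut into the sum of the two ways of placing one dot on one of the two sides of the cut. A handle is twice a dot. A cobordism $C:q^iA\to q^jB$ has degree $\chi(C)-n+j-i$, where each dot contributes $-2$ and $\alpha$ has degree $-4$. Let $\mathrm{Kom}(n)$ be the category of cochain complexes of formal finite direct sums of objects of $\mathrm{Cob}(n)$. The complex of a tangle diagram is the (signed) cube of resolutions in which a positive crossing is replaced by $q\,R_0\to q^2R_1$ in homological degrees $0,1$ and a negative crossing by $q^{-2}R_0\to q^{-1}R_1$ in degrees $-1,0$. Here $R_0,R_1$ are the two planar resolutions of the crossing, and the map is the saddle. An edge $e$ of a tangle diagram defines a chain endomorphism $\bullet_e$ of its complex, which puts a dot on the sheet over $e$ in each resolution. **(Handles slide through crossings.)** 1. Let $X\in\mathrm{Kom}(2)$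 be the complex of a single oriented crossing (any sign, any orientation). If $e,e'$ are the two edges of one of the two strands, on opposite sides of the crossing, then $\bullet_e\simeq-\bullet_{e'}$ as endomorphisms of $X$, through a chain homotopy of degree $-2$. 2. Let $T\in\mathrm{Kom}(2)$ be the complex of the tangle diagram on one side of the second Reidemeister move: two strands $a,b$ which cross twice, one of them (either one) running over the other at both crossings. Let $T_0\in\mathrm{Kom}(2)$ be the complex of the diagram with the two strands pulled apart. Then there is a homotopy equivalence $F:T\to T_0$ of degree $0$ (its inverse and the homotopies being of degree $0$ as well) such that, for each strand $s\in\{a,b\}$ and each choice of sign, $$F\circ(\pm\,\bullet_{s'})\;\simeq\;(\mp\,\bullet_{s})\circ F$$ through a chain homotopy of degree $-2$, where $s'$ is the middle edge of $s$, between the two crossings, and $\bullet_s$ is the dot on the strand $s$ of the diagram without crossings. In short, $\bigl(T,\pm\bullet_{s'}\bigr)\simeq\bigl(T_0,\mp\bullet_{s}\bigr)$. -/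

import Mathlib

open CategoryTheory

noncomputable section

namespace DottedCob

/-- The set obtained from the disjoint union of `X` and `Y` by gluing `f i` to `g i` for all `i`:
the pushout of sets `X ← I → Y`. -/
def Push {I X Y : Type} (f : I → X) (g : I → Y) : Type :=
  Quot (fun u v : X ⊕ Y => ∃ i, u = Sum.inl (f i) ∧ v = Sum.inr (g i))

namespace Push

variable {I X Y Z : Type} {f : I → X} {g : I → Y}

/-- The map from the left set to the pushout. -/
def inl (f : I → X) (g : I → Y) (x : X) : Push f g := Quot.mk _ (Sum.inl x)

/-- The map from the right set to the pushout. -/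
def inr (f : I → X) (g : I → Y) (y : Y) : Push f g := Quot.mk _ (Sum.inr y)

theorem glue (f : I → X) (g : I → Y) (i : I) : inl f g (f i) = inr f g (g i) :=
  Quot.sound ⟨i, rfl, rfl⟩

/-- A map out of the pushout. -/
def desc (u : X → Z) (v : Y → Z) (h : ∀ i, u (f i) = v (g i)) : Push f g → Z :=
  Quot.lift (Sum.elim u v) (by rintro _ _ ⟨b, rfl, rfl⟩; exact h b)

theorem ind {P : Push f g → Prop} (h : ∀ x, P (inl f g x)) (k : ∀ y, P (inr f g y)) (z) :
    P z := by
  rcases z with ⟨x | x⟩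
  · exact h x
  · exact k x

/-- A criterion, decidable on finite data, for a map out of the pushout to be injective. -/
theorem desc_injective (u : X → Z) (v : Y → Z) (h : ∀ i, u (f i) = v (g i))
    (hu : ∀ a a', u a = u a' → a = a' ∨ ∃ i j, f i = a ∧ f j = a' ∧ g i = g j)
    (hv : ∀ b, (∃ i, g i = b) ∨ ((∀ a, u a ≠ v b) ∧ ∀ b', v b' = v b → b' = b)) :
    Function.Injective (desc u v h) := by
  have hl : ∀ a a', u a = u a' → inl f g a = inl f g a' := by
    intro a a' haa
    rcases hu a a' haa with rfl | ⟨i, j, rfl, rfl, hij⟩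
    · rfl
    · rw [glue, glue, hij]
  have hr : ∀ a b, u a = v b → inl f g a = inr f g b := by
    intro a b hab
    rcases hv b with ⟨i, rfl⟩ | ⟨hb, -⟩
    · rw [← glue]; exact hl _ _ (hab.trans (h i).symm)
    · exact absurd hab (hb a)
  refine ind (fun a => ind (fun a' haa => hl a a' haa) (fun b hab => hr a b hab))
    (fun b => ind (fun a hab => (hr a b hab.symm).symm) (fun b' hbb => ?_))
  rcases hv b' with ⟨i, rfl⟩ | ⟨-, hb⟩
  · rw [← glue]; exact (hr _ _ ((h i).trans hbb.symm)).symm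
  · exact congrArg _ (hb b hbb)

end Push

/-- A Temperley-Lieb diagram in the disk with `2 * n` boundary points, numbered in cyclic order:
a finite set of components, each of which is an arc with two boundary points or a circle with none,
such that no two arcs cross. The place of a circle in the disk is not recorded: diagrams which
differ only in that place are isomorphic in the cobordism category. -/
structure Diag (n : ℕ) : Type 1 where
  comp : Type
  fin : Finite comp
  attach : Fin (2 * n) → comp
  fiber : ∀ x, Nat.card {p // attach p = x} = 0 ∨ Nat.card {p // attach p = x} = 2
  noncross : ∀ i j k l, i < j → j < k → k < l →
    ¬ (attach i = attach k ∧ attach j = attach l)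

attribute [instance] Diag.fin

/-- The Euler characteristics of the components: one for an arc, zero for a circle. -/
def Diag.chi {n : ℕ} (A : Diag n) : A.comp →₀ ℤ :=
  Finsupp.ofSupportFinite (fun x => if Nat.card {p // A.attach p = x} = 2 then 1 else 0)
    (Set.toFinite _)

/-- The homeomorphism type, relative to the boundary, of a dotted compact oriented surface `S` with
`∂S = A ∪ (boundary points × [0, 1]) ∪ B`, as a cobordism from `A` (bottom) to `B` (top): its
components, the components in which those of `A` and `B` lie (compatibly with the vertical walls over
the boundary points), and the Euler characteristic and number of dots of every component.
By the classification of surfaces these data determine `S` up to homeomorphism relative to the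
boundary; which data come from a surface is expressed by `Surf.Genuine` below. The embedding of `S`
in space is not recorded: modulo the neck-cutting relation every embedded cobordism is a
combination of dotted disks, which are determined up to isotopy by their boundary circles. -/
structure Surf {n : ℕ} (A B : Diag n) : Type 1 where
  comp : Type
  bot : A.comp → comp
  top : B.comp → comp
  wall : ∀ p, bot (A.attach p) = top (B.attach p)
  chi : comp →₀ ℤ
  dots : comp →₀ ℕ

namespace Surf

variable {n : ℕ} {A B C D : Diag n}

/-- Homeomorphism relative to the boundary, preserving the numbers of dots. -/
def Equivalent (S T : Surf A B) : Prop :=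
  ∃ e : S.comp ≃ T.comp, (∀ a, e (S.bot a) = T.bot a) ∧ (∀ b, e (S.top b) = T.top b) ∧
    S.chi.mapDomain e = T.chi ∧ S.dots.mapDomain e = T.dots

/-- Homeomorphism types of cobordisms. -/
instance setoid (A B : Diag n) : Setoid (Surf A B) where
  r := Equivalent
  iseqv :=
    { refl := fun S => ⟨Equiv.refl _, by simp [Finsupp.mapDomain_id]⟩
      symm := by
        rintro S T ⟨e, h1, h2, h3, h4⟩
        refine ⟨e.symm, fun a => by simp [← h1], fun a => by simp [← h2], ?_, ?_⟩
        · rw [← h3, ← Finsupp.mapDomain_comp]; simp [Finsupp.mapDomain_id]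
        · rw [← h4, ← Finsupp.mapDomain_comp]; simp [Finsupp.mapDomain_id]
      trans := by
        rintro S T U ⟨e, h1, h2, h3, h4⟩ ⟨f, k1, k2, k3, k4⟩
        refine ⟨e.trans f, fun a => by simp [h1, k1], fun a => by simp [h2, k2], ?_, ?_⟩
        · rw [Equiv.coe_trans, Finsupp.mapDomain_comp, h3, k3]
        · rw [Equiv.coe_trans, Finsupp.mapDomain_comp, h4, k4] }

/-- The product cobordism `A × [0, 1]`, with `m x` dots on the sheet over the component `x`. -/
def curtain (A : Diag n) (m : A.comp →₀ ℕ) : Surf A A where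
  comp := A.comp
  bot := id
  top := id
  wall _ := rfl
  chi := A.chi
  dots := m

/-- Stacking of cobordisms. The components are glued along the components of the middle diagram,
dots add up, and `χ(S ∪ T) = χ(S) + χ(T) - χ(S ∩ T)`. -/
def stack (S : Surf A B) (T : Surf B C) : Surf A C where
  comp := Push S.top T.bot
  bot a := Push.inl _ _ (S.bot a)
  top c := Push.inr _ _ (T.top c)
  wall p := by rw [S.wall, ← T.wall, Push.glue]
  chi := S.chi.mapDomain (Push.inl _ _) + T.chi.mapDomain (Push.inr _ _)
    - B.chi.mapDomain (fun b => Push.inl _ _ (S.top b))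
  dots := S.dots.mapDomain (Push.inl _ _) + T.dots.mapDomain (Push.inr _ _)

theorem mapDomain_sub_int {α β : Type} (f : α → β) (x y : α →₀ ℤ) :
    (x - y).mapDomain f = x.mapDomain f - y.mapDomain f :=
  map_sub (Finsupp.mapDomain.addMonoidHom f) x y

theorem stack_chi (S : Surf A B) (T : Surf B C) :
    (stack S T).chi = S.chi.mapDomain (Push.inl S.top T.bot)
      + T.chi.mapDomain (Push.inr S.top T.bot)
      - B.chi.mapDomain (fun b => Push.inl S.top T.bot (S.top b)) := rfl

theorem stack_dots (S : Surf A B) (T : Surf B C) :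
    (stack S T).dots = S.dots.mapDomain (Push.inl S.top T.bot)
      + T.dots.mapDomain (Push.inr S.top T.bot) := rfl

theorem Equivalent.of_maps {S T : Surf A B} (f : S.comp → T.comp) (g : T.comp → S.comp)
    (hg : ∀ x, g (f x) = x) (hf : ∀ x, f (g x) = x) (h1 : ∀ a, f (S.bot a) = T.bot a)
    (h2 : ∀ b, f (S.top b) = T.top b) (h3 : S.chi.mapDomain f = T.chi)
    (h4 : S.dots.mapDomain f = T.dots) : Equivalent S T :=
  ⟨⟨f, g, hg, hf⟩, h1, h2, h3, h4⟩

theorem map_map {α β γ M : Type} [AddCommMonoid M] (f : α → β) (g : β → γ) (x : α →₀ M) :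
    (x.mapDomain f).mapDomain g = x.mapDomain (fun a => g (f a)) :=
  Finsupp.mapDomain_comp.symm

theorem map_glued {X Y I Z W : Type} (i : X → Z) (j : Y → Z) (k : I → Z) (f : Z → W)
    (x : X →₀ ℤ) (y : Y →₀ ℤ) (z : I →₀ ℤ) :
    (x.mapDomain i + y.mapDomain j - z.mapDomain k).mapDomain f
      = x.mapDomain (fun a => f (i a)) + y.mapDomain (fun a => f (j a))
        - z.mapDomain (fun a => f (k a)) := by
  rw [mapDomain_sub_int, Finsupp.mapDomain_add, map_map, map_map, map_map]

theorem map_glued_nat {X Y Z W : Type} (i : X → Z) (j : Y → Z) (f : Z → W)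
    (x : X →₀ ℕ) (y : Y →₀ ℕ) :
    (x.mapDomain i + y.mapDomain j).mapDomain f
      = x.mapDomain (fun a => f (i a)) + y.mapDomain (fun a => f (j a)) := by
  rw [Finsupp.mapDomain_add, map_map, map_map]

theorem map_stack_chi {X : Type} (S : Surf A B) (T : Surf B C) (f : (stack S T).comp → X) :
    (stack S T).chi.mapDomain f = S.chi.mapDomain (fun x => f (Push.inl S.top T.bot x))
      + T.chi.mapDomain (fun x => f (Push.inr S.top T.bot x))
      - B.chi.mapDomain (fun b => f (Push.inl S.top T.bot (S.top b))) :=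
  map_glued _ _ _ _ _ _ _

theorem map_stack_dots {X : Type} (S : Surf A B) (T : Surf B C) (f : (stack S T).comp → X) :
    (stack S T).dots.mapDomain f = S.dots.mapDomain (fun x => f (Push.inl S.top T.bot x))
      + T.dots.mapDomain (fun x => f (Push.inr S.top T.bot x)) :=
  map_glued_nat _ _ _ _ _

theorem stack_congr {S S' : Surf A B} {T T' : Surf B C} (h : Equivalent S S')
    (k : Equivalent T T') : Equivalent (stack S T) (stack S' T') := by
  obtain ⟨e, h1, h2, h3, h4⟩ := h
  obtain ⟨f, k1, k2, k3, k4⟩ := k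
  refine Equivalent.of_maps
    (Push.desc (fun x => Push.inl S'.top T'.bot (e x)) (fun x => Push.inr S'.top T'.bot (f x)) ?_)
    (Push.desc (fun x => Push.inl S.top T.bot (e.symm x)) (fun x => Push.inr S.top T.bot (f.symm x)) ?_) ?_ ?_ ?_ ?_ ?_ ?_
  · intro b; rw [h2, k1, Push.glue]
  · intro b; rw [← h2, ← k1, e.symm_apply_apply, f.symm_apply_apply, Push.glue]
  · refine Push.ind (fun x => ?_) (fun x => ?_)
    · exact congrArg (Push.inl S.top T.bot) (e.symm_apply_apply x)
    · exact congrArg (Push.inr S.top T.bot) (f.symm_apply_apply x)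
  · refine Push.ind (fun x => ?_) (fun x => ?_)
    · exact congrArg (Push.inl S'.top T'.bot) (e.apply_symm_apply x)
    · exact congrArg (Push.inr S'.top T'.bot) (f.apply_symm_apply x)
  · intro a; exact congrArg (Push.inl S'.top T'.bot) (h1 a)
  · intro a; exact congrArg (Push.inr S'.top T'.bot) (k2 a)
  · refine (map_stack_chi _ _ _).trans ?_
    rw [stack_chi, ← h3, ← k3, map_map, map_map]
    simp only [← h2]
    rfl
  · refine (map_stack_dots _ _ _).trans ?_
    rw [stack_dots, ← h4, ← k4, map_map, map_map]
    rfl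

theorem curtain_stack (m : A.comp →₀ ℕ) (S : Surf A B) :
    Equivalent (stack (curtain A m) S) { S with dots := m.mapDomain S.bot + S.dots } := by
  refine Equivalent.of_maps (Push.desc S.bot id fun _ => rfl) (Push.inr _ _) ?_ (fun _ => rfl)
    (fun _ => rfl) (fun _ => rfl) ?_ ?_
  · exact Push.ind (fun x => (Push.glue (curtain A m).top S.bot x).symm) (fun _ => rfl)
  · refine (map_stack_chi _ _ _).trans ?_
    exact (add_sub_cancel_left _ _).trans Finsupp.mapDomain_id
  · refine (map_stack_dots _ _ _).trans ?_
    exact congrArg₂ (· + ·) rfl Finsupp.mapDomain_id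

theorem stack_curtain (S : Surf A B) (m : B.comp →₀ ℕ) :
    Equivalent (stack S (curtain B m)) { S with dots := S.dots + m.mapDomain S.top } := by
  refine Equivalent.of_maps (Push.desc id S.top fun _ => rfl) (Push.inl _ _) ?_ (fun _ => rfl)
    (fun _ => rfl) (fun _ => rfl) ?_ ?_
  · exact Push.ind (fun _ => rfl) (fun x => Push.glue S.top (curtain B m).bot x)
  · refine (map_stack_chi _ _ _).trans ?_
    rw [add_sub_assoc]
    exact Eq.trans (congrArg₂ (· + ·) Finsupp.mapDomain_id (sub_self _)) (add_zero _)
  · refine (map_stack_dots _ _ _).trans ?_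
    exact congrArg₂ (· + ·) Finsupp.mapDomain_id rfl

theorem stack_assoc (S : Surf A B) (T : Surf B C) (U : Surf C D) :
    Equivalent (stack (stack S T) U) (stack S (stack T U)) := by
  refine Equivalent.of_maps
    (Push.desc (Push.desc (Push.inl S.top (stack T U).bot) (fun x => Push.inr S.top (stack T U).bot (Push.inl T.top U.bot x)) ?_)
      (fun x => Push.inr S.top (stack T U).bot (Push.inr T.top U.bot x)) ?_)
    (Push.desc (fun x => Push.inl (stack S T).top U.bot (Push.inl S.top T.bot x))
      (Push.desc (fun x => Push.inl (stack S T).top U.bot (Push.inr S.top T.bot x)) (Push.inr (stack S T).top U.bot) ?_) ?_)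
    ?_ ?_ (fun _ => rfl) (fun _ => rfl) ?_ ?_
  · exact fun b => Push.glue (S).top ((stack T U)).bot b
  · exact fun c => congrArg (Push.inr S.top (stack T U).bot) (Push.glue (T).top (U).bot c)
  · exact fun c => Push.glue ((stack S T)).top (U).bot c
  · exact fun b => congrArg (Push.inl (stack S T).top U.bot) (Push.glue (S).top (T).bot b)
  · exact Push.ind (Push.ind (fun _ => rfl) (fun _ => rfl)) (fun _ => rfl)
  · exact Push.ind (fun _ => rfl) (Push.ind (fun _ => rfl) (fun _ => rfl))
  · refine (map_stack_chi _ _ _).trans ?_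
    rw [stack_chi S (stack T U)]
    refine (congrArg₂ (· - ·) (congrArg₂ (· + ·) (map_stack_chi S T _) rfl) rfl).trans ?_
    refine Eq.trans ?_ (congrArg₂ (· - ·) (congrArg₂ (· + ·) rfl (map_stack_chi T U _).symm) rfl)
    have key : ∀ s t b u c : (stack S (stack T U)).comp →₀ ℤ,
        s + t - b + u - c = s + (t + u - c) - b := by intros; abel
    exact key _ _ _ _ _
  · refine (map_stack_dots _ _ _).trans ?_
    rw [stack_dots S (stack T U)]
    refine (congrArg₂ (· + ·) (map_stack_dots S T _) rfl).trans ?_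
    refine Eq.trans ?_ (congrArg₂ (· + ·) rfl (map_stack_dots T U _).symm)
    exact add_assoc _ _ _

end Surf

/-- Diagrams and homeomorphism types of cobordism data, composed by stacking. -/
instance diagCategory (n : ℕ) : Category.{1} (Diag n) where
  Hom A B := _root_.Quotient (Surf.setoid A B)
  id A := _root_.Quotient.mk _ (Surf.curtain A 0)
  comp f g := _root_.Quotient.map₂ Surf.stack (fun _ _ h _ _ k => Surf.stack_congr h k) f g
  id_comp := by
    rintro A B ⟨S⟩; 
    refine (_root_.Quotient.sound (Surf.curtain_stack 0 S)).trans ?_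
    simp only [Finsupp.mapDomain_zero, zero_add]; rfl
  comp_id := by
    rintro A B ⟨S⟩; 
    refine (_root_.Quotient.sound (Surf.stack_curtain S 0)).trans ?_
    simp only [Finsupp.mapDomain_zero, add_zero]; rfl
  assoc := by
    rintro A B C D ⟨S⟩ ⟨T⟩ ⟨U⟩; exact _root_.Quotient.sound (Surf.stack_assoc S T U)


namespace Surf

variable {n : ℕ} {A B : Diag n}

/-- The boundary circles of a cobordism from `A` to `B`, i.e. the components of the closed
1-manifold `A ∪ (boundary points × [0, 1]) ∪ B`. -/
def Circle (A B : Diag n) : Type := Push A.attach B.attach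

/-- The component of the cobordism on which a boundary circle lies. -/
def carrier (S : Surf A B) : Circle A B → S.comp := Push.desc S.bot S.top S.wall

/-- The data come from a compact oriented surface: there are finitely many components and
`χ = 2 - 2 g - b` on each of them, for some genus `g`, where `b` is the number of boundary circles. -/
def Genuine (S : Surf A B) : Prop :=
  Finite S.comp ∧
    ∀ x, ∃ g : ℕ, S.chi x = 2 - 2 * (g : ℤ) - (Nat.card {c // S.carrier c = x} : ℤ)

/-- Disjoint union with a sphere with `d` dots. -/
def addSphere (S : Surf A B) (d : ℕ) : Surf A B where
  comp := Option S.comp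
  bot a := some (S.bot a)
  top b := some (S.top b)
  wall p := congrArg some (S.wall p)
  chi := S.chi.mapDomain some + Finsupp.single none 2
  dots := S.dots.mapDomain some + Finsupp.single none d

/-- One more dot on the component `x`. -/
def addDot (S : Surf A B) (x : S.comp) : Surf A B :=
  { S with dots := S.dots + Finsupp.single x 1 }

/-- Attach a tube which joins the components `x` and `y` (a handle if `x = y`). Cutting the neck
of this tube gives `S` back. -/
def addTube (S : Surf A B) (x y : S.comp) : Surf A B where
  comp := Quot (fun u v : S.comp => u = x ∧ v = y)
  bot a := Quot.mk _ (S.bot a)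
  top b := Quot.mk _ (S.top b)
  wall p := congrArg _ (S.wall p)
  chi := S.chi.mapDomain (Quot.mk _) - Finsupp.single (Quot.mk _ x) 2
  dots := S.dots.mapDomain (Quot.mk _)

end Surf

/-- The morphism represented by a surface. -/
def Surf.cls {n : ℕ} {A B : Diag n} (S : Surf A B) : A ⟶ B := _root_.Quotient.mk _ S

/-- The morphisms given by dotted surfaces. -/
def isSurface (n : ℕ) : MorphismProperty (Diag n) :=
  fun A B f => ∃ S : Surf A B, f = S.cls ∧ S.Genuine

/-- Cobordisms. Since a stack of surfaces is a surface, taking composites adds nothing;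
it spares a proof of that fact. -/
def isCobordism (n : ℕ) : MorphismProperty (Diag n) :=
  (isSurface n).multiplicativeClosure

/-- A formally `q`-graded diagram `q^i A`. -/
structure QDiag (n : ℕ) : Type 1 where
  q : ℤ
  diag : Diag n

/-- `q`-graded diagrams and cobordisms of arbitrary degree. -/
instance qdiagCategory (n : ℕ) : Category.{1} (QDiag n) where
  Hom X Y := {f : X.diag ⟶ Y.diag // isCobordism n f}
  id X := ⟨𝟙 X.diag, MorphismProperty.multiplicativeClosure.id X.diag⟩
  comp f g := ⟨f.1 ≫ g.1, (isSurface n).multiplicativeClosure.comp_mem _ _ f.2 g.2⟩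
  id_comp f := Subtype.ext (Category.id_comp f.1)
  comp_id f := Subtype.ext (Category.comp_id f.1)
  assoc f g h := Subtype.ext (Category.assoc f.1 g.1 h.1)

/-- The degree `χ - n + j - i` of a cobordism `q^i A → q^j B`. A dot counts as `-2`, since a handle is
twice a dot and lowers the Euler characteristic by `2`. -/
def HasDegree {n : ℕ} {X Y : QDiag n} (f : X ⟶ Y) (d : ℤ) : Prop :=
  ∃ S : Surf X.diag Y.diag, f.1 = S.cls ∧
    d = (S.chi.sum fun _ k => k) - 2 * (S.dots.sum fun _ k => (k : ℤ)) - n + Y.q - X.q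

/-- The ground ring `ℤ[α]`. -/
abbrev Base : Type := Polynomial ℤ

/-- The variable `α`. -/
def alpha : Base := Polynomial.X

/-- The category whose morphisms are `ℤ[α]`-linear combinations of dotted cobordisms. -/
abbrev PreCob (n : ℕ) : Type 1 := Free Base (QDiag n)

/-- A cobordism as a generator of the linear category. -/
def gen {n : ℕ} {X Y : QDiag n} (f : X ⟶ Y) :
    (Free.of Base X : PreCob n) ⟶ Free.of Base Y := (Free.embedding Base (QDiag n)).map f

theorem gen_comp {n : ℕ} {X Y Z : QDiag n} (f : X ⟶ Y) (g : Y ⟶ Z) :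
    gen (f ≫ g) = gen f ≫ gen g := (Free.embedding Base (QDiag n)).map_comp f g

/-- The local relations: a sphere with 0, 1, 2, 3 dots is `0`, `1`, `0`, `α`, and a neck is cut into
the sum of the two ways to put a dot on one of its sides. -/
inductive LocalRel {n : ℕ} {X Y : QDiag n} :
    ((Free.of Base X : PreCob n) ⟶ Free.of Base Y) → Prop
  | sphere (S : Surf X.diag Y.diag) (f : X ⟶ Y) (hf : f.1 = (S.addSphere 0).cls) :
      LocalRel (gen f)
  | sphere_dot (S : Surf X.diag Y.diag) (f g : X ⟶ Y)
      (hf : f.1 = (S.addSphere 1).cls) (hg : g.1 = S.cls) :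
      LocalRel (gen f - gen g)
  | sphere_dot_dot (S : Surf X.diag Y.diag) (f : X ⟶ Y)
      (hf : f.1 = (S.addSphere 2).cls) :
      LocalRel (gen f)
  | sphere_dot_dot_dot (S : Surf X.diag Y.diag) (f g : X ⟶ Y)
      (hf : f.1 = (S.addSphere 3).cls) (hg : g.1 = S.cls) :
      LocalRel (gen f - alpha • gen g)
  | neck (S : Surf X.diag Y.diag) (x y : S.comp) (f g h : X ⟶ Y)
      (hf : f.1 = (S.addTube x y).cls) (hg : g.1 = (S.addDot x).cls)
      (hh : h.1 = (S.addDot y).cls) :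
      LocalRel (gen f - (gen g + gen h))

/-- The two-sided ideal generated by the local relations. -/
def relIdeal {n : ℕ} (X Y : PreCob n) : AddSubgroup (X ⟶ Y) :=
  AddSubgroup.closure {r | ∃ (X' Y' : QDiag n) (u : X ⟶ Free.of Base X')
    (s : (Free.of Base X' : PreCob n) ⟶ Free.of Base Y') (v : Free.of Base Y' ⟶ Y),
    LocalRel s ∧ r = u ≫ s ≫ v}

/-- Congruence modulo the local relations. -/
def rel (n : ℕ) : HomRel (PreCob n) := fun X Y f g => f - g ∈ relIdeal X Y

theorem relIdeal_comp_left {n : ℕ} {X Y Z : PreCob n} (w : X ⟶ Y) {f : Y ⟶ Z}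
    (hf : f ∈ relIdeal Y Z) : w ≫ f ∈ relIdeal X Z := by
  induction hf using AddSubgroup.closure_induction with
  | mem r h =>
    obtain ⟨X', Y', u, s, v, hs, rfl⟩ := h
    exact AddSubgroup.subset_closure ⟨X', Y', w ≫ u, s, v, hs, (Category.assoc _ _ _).symm⟩
  | zero => rw [Limits.comp_zero]; exact zero_mem _
  | add _ _ _ _ h k => rw [Preadditive.comp_add]; exact add_mem h k
  | neg _ _ h => rw [Preadditive.comp_neg]; exact neg_mem h

theorem relIdeal_comp_right {n : ℕ} {X Y Z : PreCob n} {f : X ⟶ Y} (w : Y ⟶ Z)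
    (hf : f ∈ relIdeal X Y) : f ≫ w ∈ relIdeal X Z := by
  induction hf using AddSubgroup.closure_induction with
  | mem r h =>
    obtain ⟨X', Y', u, s, v, hs, rfl⟩ := h
    exact AddSubgroup.subset_closure ⟨X', Y', u, s, v ≫ w, hs, by simp⟩
  | zero => rw [Limits.zero_comp]; exact zero_mem _
  | add _ _ _ _ h k => rw [Preadditive.add_comp]; exact add_mem h k
  | neg _ _ h => rw [Preadditive.neg_comp]; exact neg_mem h

instance rel_congruence (n : ℕ) : Congruence (rel n) where
  equivalence :=
    { refl := fun f => by simp only [rel, sub_self]; exact zero_mem _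
      symm := fun {f g} h => by
        have := (relIdeal _ _).neg_mem h
        change _ - _ ∈ relIdeal _ _
        rwa [neg_sub] at this
      trans := fun {f g k} h h' => by
        have := (relIdeal _ _).add_mem h h'
        change _ - _ ∈ relIdeal _ _
        rwa [sub_add_sub_cancel] at this }
  comp_left := fun w f g h => by
    have := relIdeal_comp_left w h
    rwa [Preadditive.comp_sub] at this
  comp_right := fun w h => by
    have := relIdeal_comp_right w h
    rwa [Preadditive.sub_comp] at this

/-- Bar-Natan's dotted cobordism category `Cob³_{·/l}(n)`. -/
abbrev Cob (n : ℕ) : Type 1 := CategoryTheory.Quotient (rel n)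

instance cobPreadditive (n : ℕ) : Preadditive (Cob n) :=
  CategoryTheory.Quotient.preadditive (rel n) (fun X Y f₁ f₂ g₁ g₂ h k => by
    have := (relIdeal X Y).add_mem h k
    change _ - _ ∈ relIdeal _ _
    rwa [add_sub_add_comm])


namespace Cob

variable {n : ℕ}

/-- A `q`-graded diagram as an object of the dotted cobordism category. -/
def of (X : QDiag n) : Cob n := ⟨Free.of Base X⟩

/-- The `q`-graded diagram underlying an object. -/
def label (X : Cob n) : QDiag n := X.as

/-- A cobordism as a morphism of the dotted cobordism category. -/
def mk {X Y : QDiag n} (f : X ⟶ Y) : of X ⟶ of Y := (CategoryTheory.Quotient.functor (rel n)).map (gen f)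

theorem mk_comp {X Y Z : QDiag n} (f : X ⟶ Y) (g : Y ⟶ Z) : mk (f ≫ g) = mk f ≫ mk g := by
  exact (congrArg _ (gen_comp f g)).trans ((CategoryTheory.Quotient.functor (rel n)).map_comp _ _)

/-- Homogeneous morphisms of degree `d`: the span of all `α^k` times a cobordism of degree `d + 4 k`
(`α` has degree `-4`, the degree of a sphere with three dots). -/
def IsHomogeneous {X Y : Cob n} (d : ℤ) (f : X ⟶ Y) : Prop :=
  f ∈ AddSubgroup.closure {g : X ⟶ Y | ∃ (k : ℕ) (s : label X ⟶ label Y) (e : ℤ),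
    HasDegree s e ∧ e - 4 * k = d ∧ g = (CategoryTheory.Quotient.functor (rel n)).map (alpha ^ k • gen s)}

end Cob

/-- Cochain complexes of formal direct sums of objects of the dotted cobordism category. -/
abbrev Kom (n : ℕ) : Type 1 := CochainComplex (Mat_ (Cob n)) ℤ

/-- A matrix of homogeneous morphisms of degree `d`. -/
def IsHomogeneousMat {n : ℕ} {X Y : Mat_ (Cob n)} (d : ℤ) (f : X ⟶ Y) : Prop :=
  ∀ i j, Cob.IsHomogeneous d (f i j)

/-- A chain map of internal degree `d`. -/
def IsHomogeneousMap {n : ℕ} {K L : Kom n} (d : ℤ) (f : K ⟶ L) : Prop :=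
  ∀ i, IsHomogeneousMat d (f.f i)

/-- A chain homotopy of internal degree `d`. -/
def IsHomogeneousHomotopy {n : ℕ} {K L : Kom n} {f g : K ⟶ L} (d : ℤ) (h : Homotopy f g) : Prop :=
  ∀ i j, IsHomogeneousMat d (h.hom i j)

/-- Data of a complex spread over a finite set of vertices, such as a cube of resolutions: each
vertex has a homological degree and an object, and the differential is a matrix `edge` of morphisms which
raises the degree by one and squares to zero. -/
structure CubeData (C : Type 1) [Category.{1} C] [Preadditive C] : Type 1 where
  V : Type
  fin : Fintype V
  wt : V → ℤ
  obj : V → C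
  edge : ∀ v w, obj v ⟶ obj w
  edge_wt : ∀ v w, wt v + 1 ≠ wt w → edge v w = 0
  edge_sq : ∀ v w, ∑ u, edge v u ≫ edge u w = 0

attribute [instance] CubeData.fin

namespace CubeData

variable {C : Type 1} [Category.{1} C] [Preadditive C]

theorem sum_weight (K : CubeData C) {M : Type 1} [AddCommMonoid M] (j : ℤ) (F : K.V → M)
    (hF : ∀ u, K.wt u ≠ j → F u = 0) : ∑ u : {u // K.wt u = j}, F u.1 = ∑ u, F u := by
  rw [← Finset.sum_subtype (Finset.univ.filter fun u => K.wt u = j) (by simp) F]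
  refine Finset.sum_subset (Finset.filter_subset _ _) fun u _ hu => hF u ?_
  simpa using hu

/-- The total complex: in degree `i`, the formal direct sum of the objects of the vertices of degree `i`. -/
def complex (K : CubeData C) : CochainComplex (Mat_ C) ℤ where
  X i := { ι := {v : K.V // K.wt v = i}, X := fun v => K.obj v.1 }
  d _ _ := fun v w => K.edge v.1 w.1
  shape i j hij := by
    refine Mat_.hom_ext _ _ fun v w => ?_
    refine K.edge_wt v.1 w.1 fun h => hij ?_
    rw [v.2, w.2] at h
    exact h
  d_comp_d' i j k hij hjk := by
    refine Mat_.hom_ext _ _ fun v w => ?_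
    refine (K.sum_weight j (fun u => K.edge v.1 u ≫ K.edge u w.1) fun u hu => ?_).trans
      (K.edge_sq v.1 w.1)
    rw [K.edge_wt v.1 u, Limits.zero_comp]
    rw [v.2]
    exact fun h => hu (h.symm.trans hij)

open Classical in
/-- A family of endomorphisms of the vertices as a matrix. -/
def diagonal (K : CubeData C) (φ : ∀ v, K.obj v ⟶ K.obj v) (v w : K.V) : K.obj v ⟶ K.obj w :=
  if h : v = w then φ v ≫ eqToHom (congrArg K.obj h) else 0

theorem diagonal_self (K : CubeData C) (φ : ∀ v, K.obj v ⟶ K.obj v) (v : K.V) :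
    K.diagonal φ v v = φ v := by simp [diagonal]

theorem diagonal_ne (K : CubeData C) (φ : ∀ v, K.obj v ⟶ K.obj v) {v w : K.V} (h : v ≠ w) :
    K.diagonal φ v w = 0 := by simp [diagonal, h]

/-- The chain endomorphism given by endomorphisms of the vertices which commute with the edges. -/
def diagonalMap (K : CubeData C) (φ : ∀ v, K.obj v ⟶ K.obj v)
    (hφ : ∀ v w, φ v ≫ K.edge v w = K.edge v w ≫ φ w) : K.complex ⟶ K.complex where
  f _ := fun v w => K.diagonal φ v.1 w.1
  comm' i j hij := by
    refine Mat_.hom_ext _ _ fun v w => ?_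
    refine (K.sum_weight i (fun u => K.diagonal φ v.1 u ≫ K.edge u w.1) fun u hu => ?_).trans
      (Eq.trans ?_ (K.sum_weight j (fun u => K.edge v.1 u ≫ K.diagonal φ u w.1)
        fun u hu => ?_).symm)
    · rw [K.diagonal_ne φ (fun h : v.1 = u => hu (h ▸ v.2)), Limits.zero_comp]
    · rw [Finset.sum_eq_single v.1, Finset.sum_eq_single w.1, diagonal_self, diagonal_self, hφ]
      · intro u _ hu; rw [K.diagonal_ne φ hu, Limits.comp_zero]
      · simp
      · intro u _ hu; rw [K.diagonal_ne φ hu.symm, Limits.zero_comp]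
      · simp
    · rw [K.diagonal_ne φ (fun h : u = w.1 => hu (h ▸ w.2)), Limits.comp_zero]

end CubeData


theorem Diag.chi_apply {n : ℕ} (A : Diag n) (x : A.comp) :
    A.chi x = if Nat.card {p // A.attach p = x} = 2 then 1 else 0 := rfl

namespace Surf

variable {n : ℕ} {A B C : Diag n}

theorem curtain_genuine (A : Diag n) (m : A.comp →₀ ℕ) : (curtain A m).Genuine := by
  suffices H : ∀ x : A.comp, A.chi x = 2 - 2 * ((0 : ℕ) : ℤ)
      - (Nat.card {c : Circle A A // (curtain A m).carrier c = x} : ℤ) from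
    ⟨A.fin, fun x => ⟨0, H x⟩⟩
  intro x
  rw [Diag.chi_apply]
  have hall : ∀ c : {c : Circle A A // (curtain A m).carrier c = x},
      c.1 = Push.inl _ _ x ∨ c.1 = Push.inr _ _ x := by
    have aux : ∀ c : Circle A A, (curtain A m).carrier c = x →
        c = Push.inl _ _ x ∨ c = Push.inr _ _ x :=
      Push.ind (fun a ha => Or.inl (congrArg _ ha)) (fun a ha => Or.inr (congrArg _ ha))
    exact fun c => aux c.1 c.2
  rcases A.fiber x with h | h
  · have hno : ∀ p, A.attach p ≠ x := by
      intro p hp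
      have := Finite.card_eq_zero_iff.1 h
      exact this.elim ⟨p, hp⟩
    have hne : (Push.inl A.attach A.attach x) ≠ Push.inr A.attach A.attach x := by
      intro he
      have := congrArg (Push.desc (f := A.attach) (g := A.attach) (fun a => a = x)
        (fun _ => False) (fun p => eq_false (hno p))) he
      exact this.mp rfl
    have h2 : Nat.card {c : Circle A A // (curtain A m).carrier c = x} = 2 := by
      rw [Nat.card_eq_two_iff]
      refine ⟨⟨Push.inl _ _ x, rfl⟩, ⟨Push.inr _ _ x, rfl⟩, fun h => hne (congrArg Subtype.val h),
        Set.eq_univ_of_forall fun c => ?_⟩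
      rcases hall c with h | h
      · exact Or.inl (Subtype.ext h)
      · exact Or.inr (Subtype.ext h)
    rw [h, h2]; norm_num
  · have hp : ∃ p, A.attach p = x := by
      by_contra hno
      push Not at hno
      have : IsEmpty {p // A.attach p = x} := ⟨fun p => hno p.1 p.2⟩
      simp at h
    obtain ⟨p, rfl⟩ := hp
    have h1 : Nat.card {c : Circle A A // (curtain A m).carrier c = A.attach p} = 1 := by
      rw [Nat.card_eq_one_iff_unique]
      refine ⟨⟨fun c d => Subtype.ext ?_⟩, ⟨Push.inl _ _ (A.attach p), rfl⟩⟩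
      have := Push.glue A.attach A.attach p
      rcases hall c with h | h <;> rcases hall d with h' | h' <;> rw [h, h']
      · exact this
      · exact this.symm
    rw [h, h1]; norm_num

/-- Two connected cobordisms with the same Euler characteristic and number of dots agree. -/
theorem Equivalent.of_connected {S T : Surf A B} (x : S.comp) (y : T.comp)
    (hS : ∀ z, z = x) (hT : ∀ z, z = y)
    (hchi : (S.chi.mapDomain fun _ => ()) = T.chi.mapDomain fun _ => ())
    (hdots : (S.dots.mapDomain fun _ => ()) = T.dots.mapDomain fun _ => ()) :
    Equivalent S T := by
  have key : ∀ {M : Type} [AddCommMonoid M] (a : S.comp →₀ M) (b : T.comp →₀ M),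
      (a.mapDomain fun _ => ()) = b.mapDomain (fun _ => ()) → a.mapDomain (fun _ => y) = b := by
    intro M _ a b h
    have h' := congrArg (Finsupp.mapDomain fun _ => y) h
    rw [map_map, map_map] at h'
    refine h'.trans ((congrArg (fun k => Finsupp.mapDomain k b) ?_).trans Finsupp.mapDomain_id)
    funext z; exact (hT z).symm
  exact Equivalent.of_maps (fun _ => y) (fun _ => x) (fun z => (hS z).symm)
    (fun z => (hT z).symm) (fun _ => (hT _).symm) (fun _ => (hT _).symm) (key _ _ hchi)
    (key _ _ hdots)

end Surf

/-- A diagram obtained by resolving the crossings of a tangle diagram with set of edges `E`: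
`bd` gives the edges at the boundary points, and `lab e` is the component which contains the edge `e`. -/
structure Marked {n : ℕ} {E : Type} (bd : Fin (2 * n) → E) : Type 1 extends Diag n where
  lab : E → comp
  lab_surj : Function.Surjective lab
  attach_lab : ∀ p, attach p = lab (bd p)

namespace Marked

variable {n : ℕ} {E : Type} {bd : Fin (2 * n) → E}

/-- The resolved diagram with components `Fin m` in which the edge `e` lies on the component `t e`. -/
def ofTable {k m : ℕ} (bd : Fin (2 * n) → Fin k) (t : Fin k → Fin m)
    (hs : ∀ x, ∃ e, t e = x)
    (hf : ∀ x, Fintype.card {p // t (bd p) = x} = 0 ∨ Fintype.card {p // t (bd p) = x} = 2)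
    (hn : ∀ i j k l, i < j → j < k → k < l → ¬ (t (bd i) = t (bd k) ∧ t (bd j) = t (bd l))) :
    Marked bd where
  comp := Fin m
  fin := inferInstance
  attach p := t (bd p)
  fiber x := by simpa only [Nat.card_eq_fintype_card] using hf x
  noncross := hn
  lab := t
  lab_surj := hs
  attach_lab _ := rfl

/-- The identity cobordism with a dot on the sheet over the edge `e`. -/
def dotSurf (A : Marked bd) (e : E) : Surf A.toDiag A.toDiag :=
  Surf.curtain A.toDiag (Finsupp.single (A.lab e) 1)

/-- The saddle cobordism between two resolutions `A` and `B` of a tangle diagram which differ at one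
crossing, where `e` is any edge at that crossing. It is vertical away from the crossing, so the sheet over
an edge joins its component in `A` to its component in `B`; the saddle point lowers the Euler
characteristic of `A × [0, 1]` by one on the component which contains it. -/
def saddle (A B : Marked bd) (e : E) : Surf A.toDiag B.toDiag where
  comp := Push A.lab B.lab
  bot := Push.inl _ _
  top := Push.inr _ _
  wall p := by rw [A.attach_lab, B.attach_lab, Push.glue]
  chi := A.chi.mapDomain (Push.inl _ _) - Finsupp.single (Push.inl _ _ (A.lab e)) 1
  dots := 0

theorem dot_saddle (A B : Marked bd) (e₀ e : E) :
    Surf.Equivalent (Surf.stack (A.dotSurf e) (saddle A B e₀))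
      (Surf.stack (saddle A B e₀) (B.dotSurf e)) := by
  refine (Surf.setoid _ _).trans (Surf.curtain_stack _ _)
    ((Surf.setoid _ _).trans ?_ ((Surf.setoid _ _).symm (Surf.stack_curtain _ _)))
  have : (Finsupp.single (A.lab e) 1).mapDomain (saddle A B e₀).bot + (saddle A B e₀).dots
      = (saddle A B e₀).dots + (Finsupp.single (B.lab e) 1).mapDomain (saddle A B e₀).top := by
    rw [Finsupp.mapDomain_single, Finsupp.mapDomain_single, add_comm]
    exact congrArg (fun x => (saddle A B e₀).dots + Finsupp.single x 1) (Push.glue A.lab B.lab e)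
  rw [this]

theorem saddle_connected (A B C : Marked bd) (a b e₀ : E)
    (h : ∀ e, A.lab e = A.lab e₀ ∨ ∃ e', C.lab e = C.lab e' ∧ A.lab e' = A.lab e₀) :
    ∀ z : (Surf.stack (saddle A B a) (saddle B C b)).comp,
      z = Push.inl _ _ (Push.inl _ _ (A.lab e₀)) := by
  have g1 : ∀ e, (Push.inl A.lab B.lab (A.lab e)) = Push.inr A.lab B.lab (B.lab e) := Push.glue _ _
  have g2 : ∀ e, (Push.inl B.lab C.lab (B.lab e)) = Push.inr B.lab C.lab (C.lab e) := Push.glue _ _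
  have g3 : ∀ e, Push.inl (saddle A B a).top (saddle B C b).bot (Push.inr A.lab B.lab (B.lab e))
      = Push.inr (saddle A B a).top (saddle B C b).bot (Push.inl B.lab C.lab (B.lab e)) :=
    fun e => Push.glue (saddle A B a).top (saddle B C b).bot (B.lab e)
  have key : ∀ e, Push.inl (saddle A B a).top (saddle B C b).bot (Push.inl A.lab B.lab (A.lab e))
      = Push.inl _ _ (Push.inl _ _ (A.lab e₀)) := by
    intro e
    rcases h e with he | ⟨e', he, he'⟩
    · rw [he]; rfl
    · rw [← he', g1, g3, g2, he, ← g2, ← g3, ← g1]; rfl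
  refine Push.ind (Push.ind (fun x => ?_) (fun x => ?_)) (Push.ind (fun x => ?_) (fun x => ?_))
  · obtain ⟨e, rfl⟩ := A.lab_surj x; exact key e
  · obtain ⟨e, rfl⟩ := B.lab_surj x; rw [← g1]; exact key e
  · obtain ⟨e, rfl⟩ := B.lab_surj x; rw [← g3, ← g1]; exact key e
  · obtain ⟨e, rfl⟩ := C.lab_surj x; rw [← g2, ← g3, ← g1]; exact key e

theorem saddle_saddle_chi (A B C : Marked bd) (a b : E) :
    ((Surf.stack (saddle A B a) (saddle B C b)).chi.mapDomain fun _ => ())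
      = (A.chi.mapDomain fun _ => ()) - Finsupp.single () 2 := by
  have h : ∀ (A B : Marked bd) (a : E), ((saddle A B a).chi.mapDomain fun _ => ())
      = (A.chi.mapDomain fun _ => ()) - Finsupp.single () 1 := by
    intro A B a
    have key : ∀ {P : Type} (f : A.comp → P) (y : P),
        ((A.chi.mapDomain f - Finsupp.single y 1).mapDomain fun _ => ())
          = (A.chi.mapDomain fun _ => ()) - Finsupp.single () 1 := by
      intro P f y
      rw [Surf.mapDomain_sub_int, Surf.map_map, Finsupp.mapDomain_single]
    exact key _ _
  rw [Surf.map_stack_chi, h, h]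
  rw [show (2 : ℤ) = 1 + 1 from rfl, Finsupp.single_add]
  abel

theorem saddle_square (A B B' C : Marked bd) (a b a' b' e₀ : E)
    (h : ∀ e, A.lab e = A.lab e₀ ∨ ∃ e', C.lab e = C.lab e' ∧ A.lab e' = A.lab e₀) :
    Surf.Equivalent (Surf.stack (saddle A B a) (saddle B C b))
      (Surf.stack (saddle A B' b') (saddle B' C a')) := by
  refine Surf.Equivalent.of_connected _ _ (saddle_connected A B C a b e₀ h)
    (saddle_connected A B' C b' a' e₀ h) ?_ ?_
  · rw [saddle_saddle_chi, saddle_saddle_chi]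
  · rw [Surf.map_stack_dots, Surf.map_stack_dots]
    simp [saddle]


/-- A finite, decidable criterion for a saddle between two tabulated diagrams to be a surface. -/
theorem saddle_genuine {k a b m r : ℕ} {bd : Fin (2 * n) → Fin k} (tA : Fin k → Fin a)
    (tB : Fin k → Fin b) (sA fA nA sB fB nB) (e : Fin k)
    (u : Fin a → Fin m) (v : Fin b → Fin m) (huv : ∀ e, u (tA e) = v (tB e))
    (hu : ∀ x x', u x = u x' → x = x' ∨ ∃ i j, tA i = x ∧ tA j = x' ∧ tB i = tB j)
    (hv : ∀ y, (∃ i, tB i = y) ∨ ((∀ x, u x ≠ v y) ∧ ∀ y', v y' = v y → y' = y))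
    (u' : Fin a → Fin r) (v' : Fin b → Fin r) (huv' : ∀ p, u' (tA (bd p)) = v' (tB (bd p)))
    (hu' : ∀ x x', u' x = u' x' → x = x' ∨
      ∃ i j, tA (bd i) = x ∧ tA (bd j) = x' ∧ tB (bd i) = tB (bd j))
    (hv' : ∀ y, (∃ i, tB (bd i) = y) ∨ ((∀ x, u' x ≠ v' y) ∧ ∀ y', v' y' = v' y → y' = y))
    (hs : ∀ j, (∃ x, u' x = j) ∨ ∃ y, v' y = j)
    (car : Fin r → Fin m) (hcu : ∀ x, car (u' x) = u x) (hcv : ∀ y, car (v' y) = v y)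
    (hchi : ∀ i, (∑ x, if u x = i then
        (if Fintype.card {p // tA (bd p) = x} = 2 then (1 : ℤ) else 0) else 0)
      - (if u (tA e) = i then 1 else 0) = 2 - (Fintype.card {j // car j = i} : ℤ)) :
    (saddle (ofTable bd tA sA fA nA) (ofTable bd tB sB fB nB) e).Genuine := by
  set A := ofTable bd tA sA fA nA
  set B := ofTable bd tB sB fB nB
  let φ : Push tA tB → Fin m := Push.desc u v huv
  have hφ : Function.Injective φ := Push.desc_injective u v huv hu hv
  let ψ : Push (fun p => tA (bd p)) (fun p => tB (bd p)) → Fin r := Push.desc u' v' huv'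
  have hψ : Function.Injective ψ := Push.desc_injective u' v' huv' hu' hv'
  have hcar : ∀ c : Surf.Circle A.toDiag B.toDiag, φ ((saddle A B e).carrier c) = car (ψ c) :=
    Push.ind (fun x => (hcu x).symm) (fun y => (hcv y).symm)
  have hcirc : ∀ x : Push tA tB, Nat.card {c : Surf.Circle A.toDiag B.toDiag //
      (saddle A B e).carrier c = x} = Fintype.card {j // car j = φ x} := by
    intro x
    rw [← Nat.card_eq_fintype_card]
    refine Nat.card_congr (Equiv.ofBijective
      (fun c => ⟨ψ c.1, (hcar c.1).symm.trans (congrArg φ c.2)⟩) ⟨?_, ?_⟩)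
    · intro c d h
      exact Subtype.ext (hψ (congrArg Subtype.val h))
    · rintro ⟨j, hj⟩
      rcases hs j with ⟨y, rfl⟩ | ⟨y, rfl⟩
      · exact ⟨⟨Push.inl _ _ y, hφ ((hcar (Push.inl _ _ y)).trans hj)⟩, rfl⟩
      · exact ⟨⟨Push.inr _ _ y, hφ ((hcar (Push.inr _ _ y)).trans hj)⟩, rfl⟩
  have hfin : Finite (Push tA tB) := Finite.of_injective φ hφ
  let cA : Fin a →₀ ℤ := A.chi
  let ch : Push tA tB →₀ ℤ := cA.mapDomain (Push.inl tA tB)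
      - Finsupp.single (Push.inl tA tB (tA e)) 1
  have hval : ∀ x : Push tA tB,
      ch x = 2 - 2 * ((0 : ℕ) : ℤ) - (Fintype.card {j // car j = φ x} : ℤ) := by
    intro x
    rw [← Finsupp.mapDomain_apply hφ, Surf.mapDomain_sub_int, Surf.map_map, Finsupp.mapDomain_single]
    have h1 : ∀ c : Fin a →₀ ℤ, (c.mapDomain fun y => φ (Push.inl tA tB y)) (φ x)
        = ∑ y, if u y = φ x then c y else 0 := by
      intro c
      rw [Finsupp.mapDomain, Finsupp.sum_fintype _ _ (by simp), Finsupp.finsetSum_apply]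
      simp only [Finsupp.single_apply]
      rfl
    have h2 := hchi (φ x)
    rw [Finsupp.sub_apply, Finsupp.single_apply]
    simp only [Nat.cast_zero, mul_zero, sub_zero]
    rw [← h2]
    refine congrArg₂ (· - ·) ((h1 _).trans ?_) rfl
    refine Finset.sum_congr rfl fun y _ => ?_
    refine if_congr Iff.rfl ?_ rfl
    change (if Nat.card {p // tA (bd p) = y} = 2 then (1 : ℤ) else 0) = _
    rw [Nat.card_eq_fintype_card]
  exact ⟨hfin, fun x => ⟨0, (hval x).trans (by rw [← hcirc x])⟩⟩

end Marked

open Marked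

/-- The two resolutions of a crossing drawn in a square: two vertical strands, or a cup and a cap
(two horizontal strands). -/
inductive Smoothing
  | vert
  | horiz

/-- The other resolution. -/
def Smoothing.swap : Smoothing → Smoothing
  | vert => horiz
  | horiz => vert

/-- The first (`false`) and second (`true`) resolution of a crossing whose first resolution is `s`. -/
def Smoothing.resolve (s : Smoothing) : Bool → Smoothing
  | false => s
  | true => s.swap

/-- The boundary points, in cyclic order, are the ends of the edges `0, 1, 2, 3`. -/
def ends (k : ℕ) (h : 4 ≤ k) (p : Fin (2 * 2)) : Fin k := ⟨p.1, p.2.trans_le h⟩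

/-- The resolutions of the tangle diagram with one crossing. Its four edges `0, 1, 2, 3` end in the
south-west, south-east, north-east and north-west corner, so one strand consists of the edges `0` and `2`
and the other of `1` and `3`. The vertical resolution joins `0` with `3` and `1` with `2`, the horizontal
one `0` with `1` and `2` with `3`. -/
def oneCrossing : Smoothing → Marked (ends 4 le_rfl)
  | .vert => ofTable _ ![(0 : Fin 2), 1, 1, 0] (by decide) (by decide) (by decide)
  | .horiz => ofTable _ ![(0 : Fin 2), 0, 1, 1] (by decide) (by decide) (by decide)

/-- The resolutions of the diagram of two strands which cross twice: a lower crossing with the edges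
`0` (south-west), `1` (south-east), `5` (north-east), `4` (north-west) and an upper crossing with the edges
`4` (south-west), `5` (south-east), `2` (north-east), `3` (north-west). One strand is `0, 5, 3` and the other
is `1, 4, 2`; the middle edges `4` and `5` bound the bigon. The arguments are the resolutions of the lower
and of the upper crossing; they join the edges at each crossing as in `oneCrossing`, and if both are
horizontal then `4` and `5` form a circle. -/
def twoCrossings : Smoothing → Smoothing → Marked (ends 6 (by norm_num))
  | .vert, .vert => ofTable _ ![(0 : Fin 2), 1, 1, 0, 0, 1] (by decide) (by decide) (by decide)
  | .horiz, .vert => ofTable _ ![(0 : Fin 2), 0, 1, 1, 1, 1] (by decide) (by decide) (by decide)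
  | .vert, .horiz => ofTable _ ![(0 : Fin 2), 0, 1, 1, 0, 0] (by decide) (by decide) (by decide)
  | .horiz, .horiz => ofTable _ ![(0 : Fin 3), 0, 1, 1, 2, 2] (by decide) (by decide) (by decide)

theorem oneCrossing_genuine (s : Smoothing) :
    (saddle (oneCrossing s) (oneCrossing s.swap) 0).Genuine := by
  cases s
  · exact saddle_genuine (m := 1) (r := 1) ![0, 1, 1, 0] ![0, 0, 1, 1]
      (by decide) (by decide) (by decide) (by decide) (by decide) (by decide) 0
      ![0, 0] ![0, 0] (by decide) (by decide) (by decide)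
      ![0, 0] ![0, 0] (by decide) (by decide) (by decide) (by decide)
      ![0] (by decide) (by decide) (by decide)
  · exact saddle_genuine (m := 1) (r := 1) ![0, 0, 1, 1] ![0, 1, 1, 0]
      (by decide) (by decide) (by decide) (by decide) (by decide) (by decide) 0
      ![0, 0] ![0, 0] (by decide) (by decide) (by decide)
      ![0, 0] ![0, 0] (by decide) (by decide) (by decide) (by decide)
      ![0] (by decide) (by decide) (by decide)

theorem twoCrossings_genuine_left (s t : Smoothing) :
    (saddle (twoCrossings s t) (twoCrossings s.swap t) 0).Genuine := by
  cases s <;> cases t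
  · exact saddle_genuine (m := 1) (r := 1) ![0, 1, 1, 0, 0, 1] ![0, 0, 1, 1, 1, 1]
      (by decide) (by decide) (by decide) (by decide) (by decide) (by decide) 0
      ![0, 0] ![0, 0] (by decide) (by decide) (by decide)
      ![0, 0] ![0, 0] (by decide) (by decide) (by decide) (by decide)
      ![0] (by decide) (by decide) (by decide)
  · exact saddle_genuine (m := 2) (r := 3) ![0, 0, 1, 1, 0, 0] ![0, 0, 1, 1, 2, 2]
      (by decide) (by decide) (by decide) (by decide) (by decide) (by decide) 0
      ![0, 1] ![0, 1, 0] (by decide) (by decide) (by decide)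
      ![0, 1] ![0, 1, 2] (by decide) (by decide) (by decide) (by decide)
      ![0, 1, 0] (by decide) (by decide) (by decide)
  · exact saddle_genuine (m := 1) (r := 1) ![0, 0, 1, 1, 1, 1] ![0, 1, 1, 0, 0, 1]
      (by decide) (by decide) (by decide) (by decide) (by decide) (by decide) 0
      ![0, 0] ![0, 0] (by decide) (by decide) (by decide)
      ![0, 0] ![0, 0] (by decide) (by decide) (by decide) (by decide)
      ![0] (by decide) (by decide) (by decide)
  · exact saddle_genuine (m := 2) (r := 3) ![0, 0, 1, 1, 2, 2] ![0, 0, 1, 1, 0, 0]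
      (by decide) (by decide) (by decide) (by decide) (by decide) (by decide) 0
      ![0, 1, 0] ![0, 1] (by decide) (by decide) (by decide)
      ![0, 1, 2] ![0, 1] (by decide) (by decide) (by decide) (by decide)
      ![0, 1, 0] (by decide) (by decide) (by decide)

theorem twoCrossings_genuine_right (s t : Smoothing) :
    (saddle (twoCrossings s t) (twoCrossings s t.swap) 2).Genuine := by
  cases s <;> cases t
  · exact saddle_genuine (m := 1) (r := 1) ![0, 1, 1, 0, 0, 1] ![0, 0, 1, 1, 0, 0]
      (by decide) (by decide) (by decide) (by decide) (by decide) (by decide) 2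
      ![0, 0] ![0, 0] (by decide) (by decide) (by decide)
      ![0, 0] ![0, 0] (by decide) (by decide) (by decide) (by decide)
      ![0] (by decide) (by decide) (by decide)
  · exact saddle_genuine (m := 1) (r := 1) ![0, 0, 1, 1, 0, 0] ![0, 1, 1, 0, 0, 1]
      (by decide) (by decide) (by decide) (by decide) (by decide) (by decide) 2
      ![0, 0] ![0, 0] (by decide) (by decide) (by decide)
      ![0, 0] ![0, 0] (by decide) (by decide) (by decide) (by decide)
      ![0] (by decide) (by decide) (by decide)
  · exact saddle_genuine (m := 2) (r := 3) ![0, 0, 1, 1, 1, 1] ![0, 0, 1, 1, 2, 2]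
      (by decide) (by decide) (by decide) (by decide) (by decide) (by decide) 2
      ![0, 1] ![0, 1, 1] (by decide) (by decide) (by decide)
      ![0, 1] ![0, 1, 2] (by decide) (by decide) (by decide) (by decide)
      ![0, 1, 1] (by decide) (by decide) (by decide)
  · exact saddle_genuine (m := 2) (r := 3) ![0, 0, 1, 1, 2, 2] ![0, 0, 1, 1, 1, 1]
      (by decide) (by decide) (by decide) (by decide) (by decide) (by decide) 2
      ![0, 1, 1] ![0, 1] (by decide) (by decide) (by decide)
      ![0, 1, 2] ![0, 1] (by decide) (by decide) (by decide) (by decide)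
      ![0, 1, 1] (by decide) (by decide) (by decide)


theorem isCobordism_of_genuine {n : ℕ} {A B : Diag n} {S : Surf A B} (h : S.Genuine) :
    isCobordism n S.cls :=
  MorphismProperty.multiplicativeClosure.of _ ⟨S, rfl, h⟩

namespace Marked

variable {n : ℕ} {E : Type} {bd : Fin (2 * n) → E}

/-- The diagram with a `q`-degree. -/
def shift (A : Marked bd) (q : ℤ) : QDiag n := ⟨q, A.toDiag⟩

/-- The dot on the sheet over the edge `e`, as an endomorphism of `q^i A`. -/
def dotCob (A : Marked bd) (q : ℤ) (e : E) : Cob.of (A.shift q) ⟶ Cob.of (A.shift q) :=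
  Cob.mk ⟨(A.dotSurf e).cls, isCobordism_of_genuine (Surf.curtain_genuine _ _)⟩

/-- The saddle, as a morphism in the dotted cobordism category. -/
def saddleCob (A B : Marked bd) (e : E) (h : (saddle A B e).Genuine) (q q' : ℤ) :
    Cob.of (A.shift q) ⟶ Cob.of (B.shift q') :=
  Cob.mk ⟨(saddle A B e).cls, isCobordism_of_genuine h⟩

theorem dotCob_saddleCob (A B : Marked bd) (e₀ : E) (h : (saddle A B e₀).Genuine) (q q' : ℤ)
    (e : E) : A.dotCob q e ≫ saddleCob A B e₀ h q q' = saddleCob A B e₀ h q q' ≫ B.dotCob q' e := by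
  rw [dotCob, dotCob, saddleCob, ← Cob.mk_comp, ← Cob.mk_comp]
  exact congrArg Cob.mk (Subtype.ext (_root_.Quotient.sound (dot_saddle A B e₀ e)))

theorem saddleCob_square (A B B' C : Marked bd) (a b a' b' e₀ : E)
    (h : ∀ e, A.lab e = A.lab e₀ ∨ ∃ e', C.lab e = C.lab e' ∧ A.lab e' = A.lab e₀)
    (h₁ : (saddle A B a).Genuine) (h₂ : (saddle B C b).Genuine)
    (h₃ : (saddle A B' b').Genuine) (h₄ : (saddle B' C a').Genuine) (q q₁ q₂ q₃ : ℤ) :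
    saddleCob A B a h₁ q q₁ ≫ saddleCob B C b h₂ q₁ q₃
      = saddleCob A B' b' h₃ q q₂ ≫ saddleCob B' C a' h₄ q₂ q₃ := by
  rw [saddleCob, saddleCob, saddleCob, saddleCob, ← Cob.mk_comp, ← Cob.mk_comp]
  exact congrArg Cob.mk (Subtype.ext (_root_.Quotient.sound (saddle_square A B B' C a b a' b' e₀ h)))

end Marked

/-- The sign of an oriented crossing. -/
inductive CrossingSign
  | pos
  | neg

/-- The homological degree of the first resolution. -/
def CrossingSign.homShift : CrossingSign → ℤ
  | pos => 0
  | neg => -1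

/-- The `q`-degree of the first resolution. -/
def CrossingSign.qShift : CrossingSign → ℤ
  | pos => 1
  | neg => -2

/-- A Boolean as an integer. -/
def bit : Bool → ℤ
  | false => 0
  | true => 1

/-- The differential of the complex of a crossing: the saddle. -/
def crossingEdge (s : Smoothing) (c : CrossingSign) : ∀ v w : Bool,
    Cob.of ((oneCrossing (s.resolve v)).shift (bit v + c.qShift)) ⟶
      Cob.of ((oneCrossing (s.resolve w)).shift (bit w + c.qShift))
  | false, true => saddleCob (oneCrossing s) (oneCrossing s.swap) 0 (oneCrossing_genuine s) _ _
  | _, _ => 0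

/-- The complex of a crossing with first resolution `s`: `q s → q² s.swap` in degrees `0, 1` if it is
positive, and `q⁻² s → q⁻¹ s.swap` in degrees `-1, 0` if it is negative. With both strands oriented upwards a
positive crossing has `s = vert` and a negative one `s = horiz`; with one strand reversed it is the other way
round. -/
def crossing (s : Smoothing) (c : CrossingSign) : CubeData (Cob 2) where
  V := Bool
  fin := inferInstance
  wt v := bit v + c.homShift
  obj v := Cob.of ((oneCrossing (s.resolve v)).shift (bit v + c.qShift))
  edge := crossingEdge s c
  edge_wt v w h := by
    cases v <;> cases w <;> first | exact absurd (by simp only [bit]; ring1) h | rfl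
  edge_sq v w := by
    have h1 : crossingEdge s c true w = 0 := by cases w <;> rfl
    have h2 : crossingEdge s c v false = 0 := by cases v <;> rfl
    rw [Fintype.sum_bool, h1, h2, Limits.comp_zero, Limits.zero_comp, add_zero]

theorem zero_comm {n : ℕ} {X Y : Cob n} (f : X ⟶ X) (g : Y ⟶ Y) :
    f ≫ (0 : X ⟶ Y) = (0 : X ⟶ Y) ≫ g := Limits.comp_zero.trans Limits.zero_comp.symm

theorem crossing_dot_comm (s : Smoothing) (c : CrossingSign) (e : Fin 4) : ∀ v w : Bool,
    (oneCrossing (s.resolve v)).dotCob _ e ≫ crossingEdge s c v w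
      = crossingEdge s c v w ≫ (oneCrossing (s.resolve w)).dotCob _ e
  | false, true => dotCob_saddleCob _ _ _ (oneCrossing_genuine s) _ _ _
  | false, false => zero_comm _ _
  | true, false => zero_comm _ _
  | true, true => zero_comm _ _

/-- The endomorphism of the complex of a crossing given by a dot on the edge `e`. -/
def crossingDot (s : Smoothing) (c : CrossingSign) (e : Fin 4) :
    (crossing s c).complex ⟶ (crossing s c).complex :=
  (crossing s c).diagonalMap (fun v => (oneCrossing (s.resolve v)).dotCob _ e) fun v w => by
    exact crossing_dot_comm s c e v w

/-- The `q`-graded resolutions of the two-crossing diagram, see `reidemeister`. -/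
def reidemeisterObj (s : Smoothing) (v : Bool × Bool) : QDiag 2 :=
  (twoCrossings (s.resolve v.1) (s.swap.resolve v.2)).shift (bit v.1 + bit v.2 - 1)

/-- The differential of the square of resolutions: saddles at the lower crossing (edge `0`) and at the
upper crossing (edge `2`), with one sign which makes the square anticommute. -/
def reidemeisterEdge (s : Smoothing) : ∀ v w : Bool × Bool,
    Cob.of (reidemeisterObj s v) ⟶ Cob.of (reidemeisterObj s w)
  | (false, false), (true, false) => saddleCob _ _ 0 (twoCrossings_genuine_left s s.swap) _ _
  | (false, true), (true, true) => saddleCob _ _ 0 (twoCrossings_genuine_left s s.swap.swap) _ _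
  | (false, false), (false, true) => saddleCob _ _ 2 (twoCrossings_genuine_right s s.swap) _ _
  | (true, false), (true, true) => -saddleCob _ _ 2 (twoCrossings_genuine_right s.swap s.swap) _ _
  | _, _ => 0

theorem reidemeister_square (s : Smoothing) :
    reidemeisterEdge s (false, false) (true, false) ≫ reidemeisterEdge s (true, false) (true, true)
      + reidemeisterEdge s (false, false) (false, true) ≫
        reidemeisterEdge s (false, true) (true, true) = 0 := by
  refine (congrArg₂ (· + ·) (Preadditive.comp_neg _ _) ?_).trans (neg_add_cancel _)
  refine saddleCob_square _ _ _ _ _ _ _ _ 4 ?_ (twoCrossings_genuine_right s s.swap)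
    (twoCrossings_genuine_left s s.swap.swap) (twoCrossings_genuine_left s s.swap)
    (twoCrossings_genuine_right s.swap s.swap) _ _ _ _
  cases s
  · change ∀ e : Fin 6, ![(0 : Fin 2), 0, 1, 1, 0, 0] e = ![(0 : Fin 2), 0, 1, 1, 0, 0] 4 ∨
      ∃ e', ![(0 : Fin 2), 0, 1, 1, 1, 1] e = ![(0 : Fin 2), 0, 1, 1, 1, 1] e' ∧
        ![(0 : Fin 2), 0, 1, 1, 0, 0] e' = ![(0 : Fin 2), 0, 1, 1, 0, 0] 4
    decide
  · change ∀ e : Fin 6, ![(0 : Fin 2), 0, 1, 1, 1, 1] e = ![(0 : Fin 2), 0, 1, 1, 1, 1] 4 ∨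
      ∃ e', ![(0 : Fin 2), 0, 1, 1, 0, 0] e = ![(0 : Fin 2), 0, 1, 1, 0, 0] e' ∧
        ![(0 : Fin 2), 0, 1, 1, 1, 1] e' = ![(0 : Fin 2), 0, 1, 1, 1, 1] 4
    decide

theorem reidemeister_edge_sq (s : Smoothing) (v w : Bool × Bool) :
    ∑ u, reidemeisterEdge s v u ≫ reidemeisterEdge s u w = 0 := by
  have h1 : reidemeisterEdge s (true, true) w = 0 := by
    obtain ⟨_ | _, _ | _⟩ := w <;> rfl
  have h2 : reidemeisterEdge s v (false, false) = 0 := by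
    obtain ⟨_ | _, _ | _⟩ := v <;> rfl
  rw [Fintype.sum_prod_type, Fintype.sum_bool, Fintype.sum_bool, Fintype.sum_bool, h1, h2,
    Limits.comp_zero, Limits.zero_comp, zero_add, add_zero]
  by_cases hv : v = (false, false)
  · by_cases hw : w = (true, true)
    · subst hv hw
      exact reidemeister_square s
    · have h3 : reidemeisterEdge s (true, false) w = 0 := by
        obtain ⟨_ | _, _ | _⟩ := w <;> first | exact absurd rfl hw | rfl
      have h4 : reidemeisterEdge s (false, true) w = 0 := by
        obtain ⟨_ | _, _ | _⟩ := w <;> first | exact absurd rfl hw | rfl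
      rw [h3, h4, Limits.comp_zero, Limits.comp_zero, add_zero]
  · have h3 : reidemeisterEdge s v (true, false) = 0 := by
      obtain ⟨_ | _, _ | _⟩ := v <;> first | exact absurd rfl hv | rfl
    have h4 : reidemeisterEdge s v (false, true) = 0 := by
      obtain ⟨_ | _, _ | _⟩ := v <;> first | exact absurd rfl hv | rfl
    rw [h3, h4, Limits.zero_comp, Limits.zero_comp, add_zero]

/-- The complex of the two-crossing diagram of the second Reidemeister move, where one strand runs over
the other at both crossings. The lower crossing has first resolution `s` and the upper one, being its mirror
image, has first resolution `s.swap`; the two values of `s` are the two choices of the upper strand. For every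
orientation the two crossings have opposite signs, so the shifts of the first resolutions add up to homological
degree `-1 = 0 + (-1)` and `q`-degree `-1 = 1 + (-2)`. -/
def reidemeister (s : Smoothing) : CubeData (Cob 2) where
  V := Bool × Bool
  fin := inferInstance
  wt v := bit v.1 + bit v.2 - 1
  obj v := Cob.of (reidemeisterObj s v)
  edge := reidemeisterEdge s
  edge_wt v w h := by
    obtain ⟨_ | _, _ | _⟩ := v <;> obtain ⟨_ | _, _ | _⟩ := w <;>
      first | exact absurd (by simp only [bit]; ring1) h | rfl
  edge_sq v w := by
    exact reidemeister_edge_sq s v w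

theorem reidemeister_dot_comm (s : Smoothing) (e : Fin 6) : ∀ v w : Bool × Bool,
    (twoCrossings (s.resolve v.1) (s.swap.resolve v.2)).dotCob _ e ≫ reidemeisterEdge s v w
      = reidemeisterEdge s v w ≫ (twoCrossings (s.resolve w.1) (s.swap.resolve w.2)).dotCob _ e
  | (false, false), (false, false) => zero_comm _ _
  | (false, false), (false, true) =>
      dotCob_saddleCob _ _ _ (twoCrossings_genuine_right s s.swap) _ _ _
  | (false, false), (true, false) =>
      dotCob_saddleCob _ _ _ (twoCrossings_genuine_left s s.swap) _ _ _
  | (false, false), (true, true) => zero_comm _ _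
  | (false, true), (false, false) => zero_comm _ _
  | (false, true), (false, true) => zero_comm _ _
  | (false, true), (true, false) => zero_comm _ _
  | (false, true), (true, true) =>
      dotCob_saddleCob _ _ _ (twoCrossings_genuine_left s s.swap.swap) _ _ _
  | (true, false), (false, false) => zero_comm _ _
  | (true, false), (false, true) => zero_comm _ _
  | (true, false), (true, false) => zero_comm _ _
  | (true, false), (true, true) => (Preadditive.comp_neg _ _).trans
      ((congrArg Neg.neg (dotCob_saddleCob _ _ _ (twoCrossings_genuine_right s.swap s.swap) _ _ _)).trans
        (Preadditive.neg_comp _ _).symm)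
  | (true, true), (false, false) => zero_comm _ _
  | (true, true), (false, true) => zero_comm _ _
  | (true, true), (true, false) => zero_comm _ _
  | (true, true), (true, true) => zero_comm _ _

/-- The endomorphism of the complex of the two-crossing diagram given by a dot on the edge `e`. -/
def reidemeisterDot (s : Smoothing) (e : Fin 6) :
    (reidemeister s).complex ⟶ (reidemeister s).complex :=
  (reidemeister s).diagonalMap (fun v => (twoCrossings (s.resolve v.1) (s.swap.resolve v.2)).dotCob _ e)
    (reidemeister_dot_comm s e)

/-- The diagram without crossings: two vertical strands, in degree zero. -/
def strands : CubeData (Cob 2) where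
  V := Unit
  fin := inferInstance
  wt _ := 0
  obj _ := Cob.of ((oneCrossing .vert).shift 0)
  edge _ _ := 0
  edge_wt _ _ _ := rfl
  edge_sq _ _ := by simp

/-- The endomorphism given by a dot on the left (`e = 0, 3`) or right (`e = 1, 2`) strand of the diagram
without crossings. -/
def strandsDot (e : Fin 4) : strands.complex ⟶ strands.complex :=
  strands.diagonalMap (fun _ => (oneCrossing .vert).dotCob 0 e)
    fun _ _ => Limits.comp_zero.trans Limits.zero_comp.symm


/-- A homotopy equivalence of internal degree zero, including its homotopies. -/
def IsGradedEquiv {n : ℕ} {K L : Kom n} (F : HomotopyEquiv K L) : Prop :=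
  IsHomogeneousMap 0 F.hom ∧ IsHomogeneousMap 0 F.inv ∧
    IsHomogeneousHomotopy 0 F.homotopyHomInvId ∧ IsHomogeneousHomotopy 0 F.homotopyInvHomId

/-- Chain homotopic through a chain homotopy of internal degree `d`. -/
def HomotopicInDegree {n : ℕ} {K L : Kom n} (d : ℤ) (f g : K ⟶ L) : Prop :=
  ∃ h : Homotopy f g, IsHomogeneousHomotopy d h

end DottedCob

end

open DottedCob

/-!
Everything is computed with explicit surfaces.

*Surfaces.* All surfaces which occur have genus zero and at most four components, so they are recorded by
tables (`Surf.tab`): the components in which those of the two diagrams lie, the Euler characteristics and the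
dots. Whether a stack of two such surfaces, a tube attached to one, or a saddle is a given tabulated surface
is decidable (`Surf.stack_tab`, `Surf.addTube_tab`, `Surf.saddle_tab`), and so is whether a table comes from a
surface (`Surf.tab_genuine`). Each identity between morphisms below is such a computation, followed by at most
one neck cutting per summand.

*One crossing.* Let `S` be the saddle of the complex. The reversed saddle `S'` is a homotopy of degree `-2`:
both `S ≫ S'` and `S' ≫ S` are the identity with a tube between the two arcs, which neck cutting turns into
the sum of the dots on the two arcs (`saddleCob_comp_saddleCob`). The edges of one strand on opposite sides of
the crossing lie on different arcs of either resolution, so this sum is the sum of their dots.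

*Two crossings.* The square of resolutions has a cup and a cap in degrees `-1` and `1`, and in degree `0` the
vertical strands `V` and the cup and cap with a circle `W`. The map `F` to the diagram without crossings is the
identity on `V`, and on `W` it is minus the composite of the disk which caps off the circle and the saddle; its
inverse is given by the identity and the saddle followed by the birth of a circle. Up to sign, the birth and death
of the circle are the homotopies, and the one identity here which needs neck cutting is `circle_relation`:
all its terms are tubes attached to the same four disks. For the dots, the homotopy of degree `-2` is the saddle
from the top vertex to `V` followed by `F`: on `V` its composite with the differential is the sum of the dots on
the two strands (`down_comp_up`), and on `W` it is the sum of the dots on the circle and on the saddle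
(`merge_comp_up`). An edge in the middle of one strand lies, in `V`, on the sheet of the other strand, so the
first sum is that of the dot on the edge and the dot on its own strand; this is where the sign comes from.
-/

noncomputable section

namespace DottedCob

/-! ### Tabulated surfaces -/

/-- The diagram with components `Fin k` whose boundary point `p` lies on the component `t p`. -/
def Diag.ofAttach {n k : ℕ} (t : Fin (2 * n) → Fin k)
    (hf : ∀ x, Nat.card {p // t p = x} = 0 ∨ Nat.card {p // t p = x} = 2)
    (hn : ∀ i j k l, i < j → j < k → k < l → ¬ (t i = t k ∧ t j = t l)) : Diag n where
  comp := Fin k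
  fin := inferInstance
  attach := t
  fiber := hf
  noncross := hn

namespace Surf

section

variable {n : ℕ} {A B : Diag n}

theorem Equivalent.of_bijective {S T : Surf A B} (f : S.comp → T.comp)
    (hf : Function.Bijective f) (h1 : ∀ a, f (S.bot a) = T.bot a)
    (h2 : ∀ b, f (S.top b) = T.top b) (h3 : S.chi.mapDomain f = T.chi)
    (h4 : S.dots.mapDomain f = T.dots) : Equivalent S T :=
  ⟨Equiv.ofBijective f hf, h1, h2, h3, h4⟩

theorem Equivalent.cls_eq {S T : Surf A B} (h : Equivalent S T) : S.cls = T.cls :=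
  _root_.Quotient.sound h

/-- The surface with components `Fin m` given by tables: `b` and `t` tell on which component the
components of the bottom and of the top diagram lie, `c` and `d` list the Euler characteristics and the
numbers of dots. -/
def tab {m : ℕ} (b : A.comp → Fin m) (t : B.comp → Fin m)
    (w : ∀ p, b (A.attach p) = t (B.attach p)) (c : Fin m → ℤ) (d : Fin m → ℕ) : Surf A B where
  comp := Fin m
  bot := b
  top := t
  wall := w
  chi := Finsupp.equivFunOnFinite.symm c
  dots := Finsupp.equivFunOnFinite.symm d

theorem mapDomain_table {X M : Type} [Fintype X] [AddCommMonoid M] {r : ℕ} (f : X → Fin r)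
    (x : X →₀ M) (j : Fin r) : x.mapDomain f j = ∑ i, if f i = j then x i else 0 := by
  rw [Finsupp.mapDomain, Finsupp.sum_fintype _ _ (by simp), Finsupp.finsetSum_apply]
  simp only [Finsupp.single_apply]

theorem glued_table {X Y Z : Type} [Fintype X] [Fintype Y] [Fintype Z] {r : ℕ} (f : X → Fin r)
    (g : Y → Fin r) (h : Z → Fin r) (x : X →₀ ℤ) (y : Y →₀ ℤ) (z : Z →₀ ℤ) (j : Fin r) :
    (x.mapDomain f + y.mapDomain g - z.mapDomain h) j = (∑ i, if f i = j then x i else 0)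
      + (∑ i, if g i = j then y i else 0) - ∑ i, if h i = j then z i else 0 := by
  rw [Finsupp.sub_apply, Finsupp.add_apply, mapDomain_table, mapDomain_table, mapDomain_table]

theorem glued_table_nat {X Y : Type} [Fintype X] [Fintype Y] {r : ℕ} (f : X → Fin r)
    (g : Y → Fin r) (x : X →₀ ℕ) (y : Y →₀ ℕ) (j : Fin r) :
    (x.mapDomain f + y.mapDomain g) j = (∑ i, if f i = j then x i else 0)
      + ∑ i, if g i = j then y i else 0 := by
  rw [Finsupp.add_apply, mapDomain_table, mapDomain_table]

theorem sub_single_table {X : Type} [Fintype X] {r : ℕ} (f : X → Fin r) (x : X →₀ ℤ) (i j : Fin r)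
    (k : ℤ) : (x.mapDomain f - Finsupp.single i k) j
      = (∑ z, if f z = j then x z else 0) - if i = j then k else 0 := by
  rw [Finsupp.sub_apply, mapDomain_table, Finsupp.single_apply]

end

section

variable {n a b c : ℕ} {tA : Fin (2 * n) → Fin a} {tB : Fin (2 * n) → Fin b}
  {tC : Fin (2 * n) → Fin c} {fA nA fB nB fC nC}

theorem ofAttach_chi (y : Fin b) : (Diag.ofAttach tB fB nB).chi y
    = if Fintype.card {p // tB p = y} = 2 then 1 else 0 := by
  refine (Diag.chi_apply _ _).trans (if_congr ?_ rfl rfl)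
  exact Eq.congr_left (Nat.card_eq_fintype_card (α := {p // tB p = y}))

/-- A decidable criterion for the stack of two tabulated surfaces to be a third one: `u` and `v` give
the components of the stack which contain the components of the two layers. -/
theorem stack_tab {m₁ m₂ m₃ : ℕ}
    {b₁ : Fin a → Fin m₁} {t₁ : Fin b → Fin m₁} {w₁ c₁ d₁}
    {b₂ : Fin b → Fin m₂} {t₂ : Fin c → Fin m₂} {w₂ c₂ d₂}
    {b₃ : Fin a → Fin m₃} {t₃ : Fin c → Fin m₃} {w₃ c₃ d₃}
    (u : Fin m₁ → Fin m₃) (v : Fin m₂ → Fin m₃) (huv : ∀ y, u (t₁ y) = v (b₂ y))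
    (hu : ∀ x x', u x = u x' → x = x' ∨ ∃ i j, t₁ i = x ∧ t₁ j = x' ∧ b₂ i = b₂ j)
    (hv : ∀ y, (∃ i, b₂ i = y) ∨ ((∀ x, u x ≠ v y) ∧ ∀ y', v y' = v y → y' = y))
    (hs : ∀ j, (∃ x, u x = j) ∨ ∃ y, v y = j)
    (hb : ∀ x, u (b₁ x) = b₃ x) (ht : ∀ y, v (t₂ y) = t₃ y)
    (hc : ∀ j, (∑ x, if u x = j then c₁ x else 0) + (∑ y, if v y = j then c₂ y else 0)
      - (∑ z, if u (t₁ z) = j then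
          (if Fintype.card {p // tB p = z} = 2 then (1 : ℤ) else 0) else 0) = c₃ j)
    (hd : ∀ j, (∑ x, if u x = j then d₁ x else 0) + (∑ y, if v y = j then d₂ y else 0) = d₃ j) :
    Equivalent
      (stack (tab (A := .ofAttach tA fA nA) (B := .ofAttach tB fB nB) b₁ t₁ w₁ c₁ d₁)
        (tab (B := .ofAttach tC fC nC) b₂ t₂ w₂ c₂ d₂))
      (tab b₃ t₃ w₃ c₃ d₃) := by
  refine Equivalent.of_bijective (Push.desc u v huv)
    ⟨Push.desc_injective u v huv hu hv, fun j => ?_⟩ hb ht ?_ ?_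
  · rcases hs j with ⟨x, hx⟩ | ⟨y, hy⟩
    · exact ⟨Push.inl _ _ x, hx⟩
    · exact ⟨Push.inr _ _ y, hy⟩
  · refine (map_stack_chi _ _ _).trans (Finsupp.ext fun j : Fin m₃ => ?_)
    refine Eq.trans ?_ (hc j)
    refine (glued_table (X := Fin m₁) (Y := Fin m₂) (Z := Fin b) u v (fun z => u (t₁ z))
      (Finsupp.equivFunOnFinite.symm c₁) (Finsupp.equivFunOnFinite.symm c₂)
      (Diag.ofAttach tB fB nB).chi j).trans (congrArg _ ?_)
    exact Finset.sum_congr rfl fun z _ => if_congr Iff.rfl (ofAttach_chi z) rfl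
  · refine (map_stack_dots _ _ _).trans (Finsupp.ext fun j => ?_)
    exact (glued_table_nat (X := Fin m₁) (Y := Fin m₂) u v (Finsupp.equivFunOnFinite.symm d₁)
      (Finsupp.equivFunOnFinite.symm d₂) j).trans (hd j)

/-- A decidable criterion for the result of attaching a tube to a tabulated surface. -/
theorem addTube_tab {m r : ℕ}
    {b₁ : Fin a → Fin m} {t₁ : Fin b → Fin m} {w₁ c₁ d₁}
    {b₃ : Fin a → Fin r} {t₃ : Fin b → Fin r} {w₃ c₃ d₃} (x y : Fin m)
    (u : Fin m → Fin r) (hxy : u x = u y)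
    (hu : ∀ z z', u z = u z' → z = z' ∨ (z = x ∧ z' = y) ∨ (z = y ∧ z' = x))
    (hs : ∀ j, ∃ z, u z = j) (hb : ∀ z, u (b₁ z) = b₃ z) (ht : ∀ z, u (t₁ z) = t₃ z)
    (hc : ∀ j, (∑ z, if u z = j then c₁ z else 0) - (if u x = j then 2 else 0) = c₃ j)
    (hd : ∀ j, (∑ z, if u z = j then d₁ z else 0) = d₃ j) :
    Equivalent
      ((tab (A := .ofAttach tA fA nA) (B := .ofAttach tB fB nB) b₁ t₁ w₁ c₁ d₁).addTube x y)
      (tab b₃ t₃ w₃ c₃ d₃) := by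
  let φ : Quot (fun p q : Fin m => p = x ∧ q = y) → Fin r :=
    Quot.lift u (by rintro _ _ ⟨rfl, rfl⟩; exact hxy)
  have hφ : Function.Bijective φ := by
    refine ⟨?_, fun j => ?_⟩
    · rintro ⟨z⟩ ⟨z'⟩ h
      rcases hu z z' h with rfl | ⟨rfl, rfl⟩ | ⟨rfl, rfl⟩
      · rfl
      · exact Quot.sound ⟨rfl, rfl⟩
      · exact (Quot.sound ⟨rfl, rfl⟩).symm
    · obtain ⟨z, rfl⟩ := hs j
      exact ⟨Quot.mk _ z, rfl⟩
  refine Equivalent.of_bijective φ hφ hb ht ?_ ?_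
  · refine Finsupp.ext fun j => Eq.trans ?_ (hc j)
    have h1 : ∀ z : Fin m →₀ ℤ, (z.mapDomain (Quot.mk _)
        - Finsupp.single (Quot.mk _ x) 2).mapDomain φ
        = z.mapDomain u - Finsupp.single (u x) 2 := fun z => by
      rw [mapDomain_sub_int, map_map, Finsupp.mapDomain_single]
    refine (congrArg (fun z : Fin r →₀ ℤ => z j) (h1 (Finsupp.equivFunOnFinite.symm c₁))).trans ?_
    exact sub_single_table u _ _ _ _
  · refine Finsupp.ext fun j => Eq.trans ?_ (hd j)
    refine (congrArg (fun z : Fin r →₀ ℕ => z j)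
      (map_map (Quot.mk _) φ (Finsupp.equivFunOnFinite.symm d₁))).trans ?_
    exact mapDomain_table u _ j

/-- A curtain as a tabulated surface. -/
theorem curtain_tab {w c d} (m : Fin a →₀ ℕ)
    (hc : ∀ x, (if Fintype.card {p // tA p = x} = 2 then (1 : ℤ) else 0) = c x)
    (hd : ∀ x, m x = d x) :
    Equivalent (curtain (Diag.ofAttach tA fA nA) m)
      (tab (A := .ofAttach tA fA nA) (B := .ofAttach tA fA nA) (m := a) id id w c d) := by
  refine Equivalent.of_bijective id Function.bijective_id (fun _ => rfl) (fun _ => rfl) ?_ ?_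
  · refine Finsupp.mapDomain_id.trans (Finsupp.ext fun x => ?_)
    exact (ofAttach_chi x).trans (hc x)
  · exact Finsupp.mapDomain_id.trans (Finsupp.ext hd)

/-- A decidable criterion for a tabulated surface to be a surface of genus zero: `u` and `v` give the
boundary circles, and `car` the components on which these lie. -/
theorem tab_genuine {m r : ℕ} {b₁ : Fin a → Fin m} {t₁ : Fin b → Fin m} {w c₁ d}
    (u : Fin a → Fin r) (v : Fin b → Fin r) (huv : ∀ p, u (tA p) = v (tB p))
    (hu : ∀ x x', u x = u x' → x = x' ∨ ∃ i j, tA i = x ∧ tA j = x' ∧ tB i = tB j)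
    (hv : ∀ y, (∃ i, tB i = y) ∨ ((∀ x, u x ≠ v y) ∧ ∀ y', v y' = v y → y' = y))
    (hs : ∀ j, (∃ x, u x = j) ∨ ∃ y, v y = j)
    (car : Fin r → Fin m) (hcu : ∀ x, car (u x) = b₁ x) (hcv : ∀ y, car (v y) = t₁ y)
    (hc : ∀ i, c₁ i = 2 - (Fintype.card {j // car j = i} : ℤ)) :
    (tab (A := .ofAttach tA fA nA) (B := .ofAttach tB fB nB) b₁ t₁ w c₁ d).Genuine := by
  let ψ : Push tA tB → Fin r := Push.desc u v huv
  have hψ : Function.Bijective ψ := by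
    refine ⟨Push.desc_injective u v huv hu hv, fun j => ?_⟩
    rcases hs j with ⟨x, hx⟩ | ⟨y, hy⟩
    · exact ⟨Push.inl _ _ x, hx⟩
    · exact ⟨Push.inr _ _ y, hy⟩
  let S := tab (A := .ofAttach tA fA nA) (B := .ofAttach tB fB nB) b₁ t₁ w c₁ d
  have hcar : ∀ z : Circle (.ofAttach tA fA nA) (.ofAttach tB fB nB), S.carrier z = car (ψ z) :=
    Push.ind (fun x => (hcu x).symm) (fun y => (hcv y).symm)
  refine ⟨inferInstanceAs (Finite (Fin m)), fun i : Fin m => ⟨0, (hc i).trans ?_⟩⟩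
  have : Nat.card {z // S.carrier z = i} = Fintype.card {j : Fin r // car j = i} :=
    (Nat.card_congr ((Equiv.ofBijective ψ hψ).subtypeEquiv fun z => by rw [hcar z]; rfl)).trans
      Nat.card_eq_fintype_card
  refine Eq.trans ?_ (congrArg (fun k : ℕ => 2 - 2 * ((0 : ℕ) : ℤ) - (k : ℤ)) this.symm)
  simp

end

section

variable {n k a b : ℕ} {bd : Fin (2 * n) → Fin k}

/-- A decidable criterion for a saddle to be a given tabulated surface. -/
theorem saddle_tab {m : ℕ} (tA : Fin k → Fin a) (tB : Fin k → Fin b) (sA fA nA sB fB nB)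
    (e : Fin k) (u : Fin a → Fin m) (v : Fin b → Fin m) {w c d}
    (huv : ∀ e, u (tA e) = v (tB e))
    (hu : ∀ x x', u x = u x' → x = x' ∨ ∃ i j, tA i = x ∧ tA j = x' ∧ tB i = tB j)
    (hv : ∀ y, (∃ i, tB i = y) ∨ ((∀ x, u x ≠ v y) ∧ ∀ y', v y' = v y → y' = y))
    (hs : ∀ j, (∃ x, u x = j) ∨ ∃ y, v y = j)
    (hc : ∀ j, (∑ x, if u x = j then
        (if Fintype.card {p // tA (bd p) = x} = 2 then (1 : ℤ) else 0) else 0)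
      - (if u (tA e) = j then 1 else 0) = c j)
    (hd : ∀ j, d j = 0) :
    Equivalent (Marked.saddle (Marked.ofTable bd tA sA fA nA) (Marked.ofTable bd tB sB fB nB) e)
      (tab (A := (Marked.ofTable bd tA sA fA nA).toDiag)
        (B := (Marked.ofTable bd tB sB fB nB).toDiag) u v w c d) := by
  let φ : Push tA tB → Fin m := Push.desc u v huv
  have hφ : Function.Bijective φ := by
    refine ⟨Push.desc_injective u v huv hu hv, fun j => ?_⟩
    rcases hs j with ⟨x, hx⟩ | ⟨y, hy⟩
    · exact ⟨Push.inl _ _ x, hx⟩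
    · exact ⟨Push.inr _ _ y, hy⟩
  refine Equivalent.of_bijective φ hφ (fun _ => rfl) (fun _ => rfl) ?_ ?_
  · refine Finsupp.ext fun j : Fin m => Eq.trans ?_ (hc j)
    have h1 : ∀ z : Fin a →₀ ℤ, (z.mapDomain (Push.inl tA tB)
        - Finsupp.single (Push.inl tA tB (tA e)) 1).mapDomain φ
        = z.mapDomain u - Finsupp.single (u (tA e)) 1 := fun z => by
      rw [mapDomain_sub_int, map_map, Finsupp.mapDomain_single]; rfl
    refine (congrArg (fun z : Fin m →₀ ℤ => z j)
      (h1 (Marked.ofTable bd tA sA fA nA).chi)).trans ?_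
    refine (sub_single_table u (Marked.ofTable bd tA sA fA nA).chi _ _ _).trans ?_
    refine congrArg (· - _) (Finset.sum_congr rfl fun z _ => if_congr Iff.rfl ?_ rfl)
    exact ofAttach_chi (tB := fun p => tA (bd p)) (fB := (Marked.ofTable bd tA sA fA nA).fiber)
      (nB := nA) z
  · exact Finsupp.mapDomain_zero.trans (Finsupp.ext fun j => (hd j).symm)

end

end Surf

/-! ### Morphisms given by surfaces, and the local relations -/

namespace Surf

variable {n a b : ℕ} {tA : Fin (2 * n) → Fin a} {tB : Fin (2 * n) → Fin b} {fA nA fB nB}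

/-- A decidable criterion for the disjoint union of a tabulated surface and a sphere. -/
theorem addSphere_tab {m r : ℕ} {b₁ : Fin a → Fin m} {t₁ : Fin b → Fin m} {w₁ c₁ d₁}
    {b₃ : Fin a → Fin r} {t₃ : Fin b → Fin r} {w₃ c₃ d₃} (k : ℕ) (u : Option (Fin m) → Fin r)
    (hu : ∀ x y, u x = u y → x = y) (hs : ∀ j, ∃ x, u x = j)
    (hb : ∀ z, u (some (b₁ z)) = b₃ z) (ht : ∀ z, u (some (t₁ z)) = t₃ z)
    (hc : ∀ j, (∑ z, if u (some z) = j then c₁ z else 0) + (if u none = j then 2 else 0) = c₃ j)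
    (hd : ∀ j, (∑ z, if u (some z) = j then d₁ z else 0) + (if u none = j then k else 0) = d₃ j) :
    Equivalent
      ((tab (A := .ofAttach tA fA nA) (B := .ofAttach tB fB nB) b₁ t₁ w₁ c₁ d₁).addSphere k)
      (tab b₃ t₃ w₃ c₃ d₃) := by
  have key : ∀ {M : Type} [AddCommMonoid M] (x : Fin m →₀ M) (y : M) (j : Fin r),
      (x.mapDomain some + Finsupp.single none y).mapDomain u j
        = (∑ z, if u (some z) = j then x z else 0) + if u none = j then y else 0 := by
    intro M _ x y j
    rw [Finsupp.mapDomain_add, map_map, Finsupp.mapDomain_single, Finsupp.add_apply,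
      mapDomain_table, Finsupp.single_apply]
  refine Equivalent.of_bijective u ⟨fun x y => hu x y, hs⟩ hb ht ?_ ?_
  · exact Finsupp.ext fun j : Fin r => (key (Finsupp.equivFunOnFinite.symm c₁) 2 j).trans (hc j)
  · exact Finsupp.ext fun j : Fin r => (key (Finsupp.equivFunOnFinite.symm d₁) k j).trans (hd j)

end Surf

namespace Cob

variable {n : ℕ} {A B C : Diag n} {q q' q'' : ℤ}

/-- A surface as a morphism of the dotted cobordism category. -/
def mkSurf (q q' : ℤ) (S : Surf A B) (h : isCobordism n S.cls) :
    of (⟨q, A⟩ : QDiag n) ⟶ of ⟨q', B⟩ := mk ⟨S.cls, h⟩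

theorem mkSurf_congr {S T : Surf A B} (h : isCobordism n S.cls) (k : isCobordism n T.cls)
    (e : Surf.Equivalent S T) : mkSurf q q' S h = mkSurf q q' T k :=
  congrArg mk (Subtype.ext e.cls_eq)

theorem mkSurf_comp {S : Surf A B} {T : Surf B C} {U : Surf A C} (hS : isCobordism n S.cls)
    (hT : isCobordism n T.cls) (hU : isCobordism n U.cls)
    (e : Surf.Equivalent (Surf.stack S T) U) :
    mkSurf q q' S hS ≫ mkSurf q' q'' T hT = mkSurf q q'' U hU :=
  (mk_comp _ _).symm.trans (congrArg mk (Subtype.ext e.cls_eq))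

theorem id_eq_mkSurf (h : isCobordism n (Surf.curtain A 0).cls) :
    𝟙 (of (⟨q, A⟩ : QDiag n)) = mkSurf q q (Surf.curtain A 0) h := by
  refine ((Quotient.functor (rel n)).map_id (Free.of Base (⟨q, A⟩ : QDiag n))).symm.trans ?_
  exact congrArg (Quotient.functor (rel n)).map
    ((Free.embedding Base (QDiag n)).map_id ⟨q, A⟩).symm

theorem map_eq_of_mem {X Y : PreCob n} {f g : X ⟶ Y} (h : f - g ∈ relIdeal X Y) :
    (Quotient.functor (rel n)).map f = (Quotient.functor (rel n)).map g :=
  CategoryTheory.Quotient.sound _ h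

theorem mem_relIdeal {X Y : QDiag n} {f : (Free.of Base X : PreCob n) ⟶ Free.of Base Y}
    (h : LocalRel f) : f ∈ relIdeal (n := n) (Free.of Base X) (Free.of Base Y) :=
  AddSubgroup.subset_closure ⟨X, Y, 𝟙 _, f, 𝟙 _, h, by simp⟩

/-- Neck cutting. -/
theorem mkSurf_neck {S U : Surf A B} (x y : S.comp) (e : Surf.Equivalent (S.addTube x y) U)
    (hU : isCobordism n U.cls) (hx : isCobordism n (S.addDot x).cls)
    (hy : isCobordism n (S.addDot y).cls) :
    mkSurf q q' U hU = mkSurf q q' (S.addDot x) hx + mkSurf q q' (S.addDot y) hy :=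
  map_eq_of_mem (mem_relIdeal (X := ⟨q, A⟩) (Y := ⟨q', B⟩)
    (LocalRel.neck S x y _ _ _ e.cls_eq.symm rfl rfl))

/-- A surface with a sphere without dots vanishes. -/
theorem mkSurf_sphere {S U : Surf A B} (e : Surf.Equivalent (S.addSphere 0) U)
    (hU : isCobordism n U.cls) : mkSurf q q' U hU = 0 := by
  refine map_eq_of_mem (g := 0) ?_
  rw [sub_zero]
  exact mem_relIdeal (X := ⟨q, A⟩) (Y := ⟨q', B⟩) (LocalRel.sphere S _ e.cls_eq.symm)

/-! ### Degrees -/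

theorem IsHomogeneous.zero {X Y : Cob n} {d : ℤ} : IsHomogeneous d (0 : X ⟶ Y) :=
  zero_mem _

theorem IsHomogeneous.neg {X Y : Cob n} {d : ℤ} {f : X ⟶ Y} (h : IsHomogeneous d f) :
    IsHomogeneous d (-f) :=
  neg_mem h

theorem IsHomogeneous.zsmul {X Y : Cob n} {d : ℤ} {f : X ⟶ Y} (m : ℤ) (h : IsHomogeneous d f) :
    IsHomogeneous d (m • f) :=
  zsmul_mem h m

theorem isHomogeneous_mkSurf (S : Surf A B) (h : isCobordism n S.cls) {d : ℤ}
    (hd : d = (S.chi.sum fun _ k => k) - 2 * (S.dots.sum fun _ k => (k : ℤ)) - n + q' - q) :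
    IsHomogeneous d (mkSurf q q' S h) := by
  refine AddSubgroup.subset_closure ⟨0, ⟨S.cls, h⟩, d, ⟨S, rfl, hd⟩, by simp, ?_⟩
  rw [pow_zero, one_smul]
  rfl

/-- The degree of a tabulated surface, computed from the table. -/
theorem isHomogeneous_tab {m : ℕ} (b : A.comp → Fin m) (t : B.comp → Fin m) {w} {c : Fin m → ℤ}
    {e : Fin m → ℕ} (h : isCobordism n (Surf.tab b t w c e).cls) {d : ℤ}
    (hd : d = (∑ i, c i) - 2 * (∑ i, (e i : ℤ)) - n + q' - q) :
    IsHomogeneous d (mkSurf q q' (Surf.tab b t w c e) h) := by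
  refine isHomogeneous_mkSurf _ _ ?_
  have h1 : ((Finsupp.equivFunOnFinite.symm c).sum fun _ k => k) = ∑ i, c i :=
    Finsupp.sum_fintype _ _ fun _ => rfl
  have h2 : ((Finsupp.equivFunOnFinite.symm e).sum fun _ k => (k : ℤ)) = ∑ i, (e i : ℤ) :=
    Finsupp.sum_fintype _ _ fun _ => rfl
  rw [hd, ← h1, ← h2]
  rfl

end Cob

theorem isCobordism_stack {n : ℕ} {A B C : Diag n} {S : Surf A B} {T : Surf B C} {U : Surf A C}
    (hS : isCobordism n S.cls) (hT : isCobordism n T.cls)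
    (e : Surf.Equivalent (Surf.stack S T) U) : isCobordism n U.cls := by
  rw [← e.cls_eq]
  exact (isSurface n).multiplicativeClosure.comp_mem _ _ hS hT

theorem isCobordism_congr {n : ℕ} {A B : Diag n} {S U : Surf A B}
    (hS : isCobordism n S.cls) (e : Surf.Equivalent S U) : isCobordism n U.cls := by
  rwa [← e.cls_eq]

open Marked Surf

/-! ### The resolutions of the two-crossing diagram -/

/-- The resolution into a cup and a cap in which the middle edges lie on the `i`-th arc. It is
`twoCrossings .vert .horiz` for `i = 0` and `twoCrossings .horiz .vert` for `i = 1`. -/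
def cupCap (i : Fin 2) : Marked (ends 6 (by norm_num)) :=
  ofTable _ ![(0 : Fin 2), 0, 1, 1, i, i] (by decide +revert) (by decide +revert)
    (by decide +revert)

/-- The resolution into a cup, a cap and a circle. -/
abbrev cupCapCircle : Marked (ends 6 (by norm_num)) := twoCrossings .horiz .horiz

/-- The resolution into two vertical strands. -/
abbrev vertical : Marked (ends 6 (by norm_num)) := twoCrossings .vert .vert

/-- The diagram of two vertical strands without crossings. -/
abbrev straight : Marked (ends 4 le_rfl) := oneCrossing .vert

section

variable (i j : Fin 2)

/-- An arc splits off a circle. -/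
def splitSurf : Surf (cupCap i).toDiag cupCapCircle.toDiag :=
  tab (m := 2) (![0, 1] : Fin 2 → Fin 2) (![0, 1, i] : Fin 3 → Fin 2) (by decide +revert)
    (fun x => if x = i then 0 else 1) 0

/-- A circle merges into an arc. -/
def mergeSurf : Surf cupCapCircle.toDiag (cupCap i).toDiag :=
  tab (m := 2) (![0, 1, i] : Fin 3 → Fin 2) (![0, 1] : Fin 2 → Fin 2) (by decide +revert)
    (fun x => if x = i then 0 else 1) 0

/-- The saddle from the cup and the cap to the vertical strands. -/
def saddleUp : Surf (cupCap i).toDiag vertical.toDiag :=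
  tab (m := 1) (![0, 0] : Fin 2 → Fin 1) (![0, 0] : Fin 2 → Fin 1) (by decide +revert) 1 0

/-- The saddle from the vertical strands to the cup and the cap. -/
def saddleDown : Surf vertical.toDiag (cupCap i).toDiag :=
  tab (m := 1) (![0, 0] : Fin 2 → Fin 1) (![0, 0] : Fin 2 → Fin 1) (by decide +revert) 1 0

/-- The circle is capped off by a disk. -/
def deathSurf : Surf cupCapCircle.toDiag (cupCap i).toDiag :=
  tab (m := 3) (![0, 1, 2] : Fin 3 → Fin 3) (![0, 1] : Fin 2 → Fin 3) (by decide +revert) 1 0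

/-- The circle is born from a disk. -/
def birthSurf : Surf (cupCap i).toDiag cupCapCircle.toDiag :=
  tab (m := 3) (![0, 1] : Fin 2 → Fin 3) (![0, 1, 2] : Fin 3 → Fin 3) (by decide +revert) 1 0

/-- The circle is capped off while a saddle joins the cup and the cap. -/
def saddleDeath : Surf cupCapCircle.toDiag vertical.toDiag :=
  tab (m := 2) (![0, 0, 1] : Fin 3 → Fin 2) (![0, 0] : Fin 2 → Fin 2) (by decide +revert) 1 0

/-- A saddle joins the vertical strands while a circle is born. -/
def saddleBirth : Surf vertical.toDiag cupCapCircle.toDiag :=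
  tab (m := 2) (![0, 0] : Fin 2 → Fin 2) (![0, 0, 1] : Fin 3 → Fin 2) (by decide +revert) 1 0

/-- The curtains over the cup and the cap together with two disks, which cap off the circle of the
bottom (component `2`) and of the top (component `3`). -/
def disksSurf : Surf cupCapCircle.toDiag cupCapCircle.toDiag :=
  tab (m := 4) (![0, 1, 2] : Fin 3 → Fin 4) (![0, 1, 3] : Fin 3 → Fin 4) (by decide +revert) 1 0

/-- The vertical strands as strands of the diagram without crossings. -/
def forgetSurf : Surf vertical.toDiag straight.toDiag :=
  tab (m := 2) (![0, 1] : Fin 2 → Fin 2) (![0, 1] : Fin 2 → Fin 2) (by decide +revert) 1 0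

/-- The strands of the diagram without crossings as vertical strands. -/
def unforgetSurf : Surf straight.toDiag vertical.toDiag :=
  tab (m := 2) (![0, 1] : Fin 2 → Fin 2) (![0, 1] : Fin 2 → Fin 2) (by decide +revert) 1 0

theorem isCobordism_split : isCobordism 2 (splitSurf i).cls :=
  isCobordism_of_genuine (tab_genuine (r := 3) (![0, 1] : Fin 2 → Fin 3) (![0, 1, 2] : Fin 3 → Fin 3)
    (by decide +revert) (by decide +revert) (by decide +revert) (by decide +revert)
    (![0, 1, i] : Fin 3 → Fin 2) (by decide +revert) (by decide +revert) (by decide +revert))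

theorem isCobordism_merge : isCobordism 2 (mergeSurf i).cls :=
  isCobordism_of_genuine (tab_genuine (r := 3) (![0, 1, 2] : Fin 3 → Fin 3) (![0, 1] : Fin 2 → Fin 3)
    (by decide +revert) (by decide +revert) (by decide +revert) (by decide +revert)
    (![0, 1, i] : Fin 3 → Fin 2) (by decide +revert) (by decide +revert) (by decide +revert))

theorem isCobordism_saddleUp : isCobordism 2 (saddleUp i).cls :=
  isCobordism_of_genuine (tab_genuine (r := 1) (![0, 0] : Fin 2 → Fin 1) (![0, 0] : Fin 2 → Fin 1)
    (by decide +revert) (by decide +revert) (by decide +revert) (by decide +revert)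
    (![0] : Fin 1 → Fin 1) (by decide +revert) (by decide +revert) (by decide +revert))

theorem isCobordism_saddleDown : isCobordism 2 (saddleDown i).cls :=
  isCobordism_of_genuine (tab_genuine (r := 1) (![0, 0] : Fin 2 → Fin 1) (![0, 0] : Fin 2 → Fin 1)
    (by decide +revert) (by decide +revert) (by decide +revert) (by decide +revert)
    (![0] : Fin 1 → Fin 1) (by decide +revert) (by decide +revert) (by decide +revert))

theorem isCobordism_death : isCobordism 2 (deathSurf i).cls :=
  isCobordism_of_genuine (tab_genuine (r := 3) (![0, 1, 2] : Fin 3 → Fin 3) (![0, 1] : Fin 2 → Fin 3)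
    (by decide +revert) (by decide +revert) (by decide +revert) (by decide +revert)
    (![0, 1, 2] : Fin 3 → Fin 3) (by decide +revert) (by decide +revert) (by decide +revert))

theorem isCobordism_birth : isCobordism 2 (birthSurf i).cls :=
  isCobordism_of_genuine (tab_genuine (r := 3) (![0, 1] : Fin 2 → Fin 3) (![0, 1, 2] : Fin 3 → Fin 3)
    (by decide +revert) (by decide +revert) (by decide +revert) (by decide +revert)
    (![0, 1, 2] : Fin 3 → Fin 3) (by decide +revert) (by decide +revert) (by decide +revert))

theorem isCobordism_disks (d : Fin 4 → ℕ) (w) :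
    isCobordism 2 (tab (A := cupCapCircle.toDiag) (B := cupCapCircle.toDiag) (m := 4)
      (![0, 1, 2] : Fin 3 → Fin 4) (![0, 1, 3] : Fin 3 → Fin 4) w 1 d).cls :=
  isCobordism_of_genuine (tab_genuine (r := 4) (![0, 1, 2] : Fin 3 → Fin 4)
    (![0, 1, 3] : Fin 3 → Fin 4) (by decide +revert) (by decide +revert) (by decide +revert) (by decide +revert)
    (![0, 1, 2, 3] : Fin 4 → Fin 4) (by decide +revert) (by decide +revert) (by decide +revert))

theorem isCobordism_forget : isCobordism 2 forgetSurf.cls :=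
  isCobordism_of_genuine (tab_genuine (r := 2) (![0, 1] : Fin 2 → Fin 2) (![0, 1] : Fin 2 → Fin 2)
    (by decide +revert) (by decide +revert) (by decide +revert) (by decide +revert)
    (![0, 1] : Fin 2 → Fin 2) (by decide +revert) (by decide +revert) (by decide +revert))

theorem isCobordism_unforget : isCobordism 2 unforgetSurf.cls :=
  isCobordism_of_genuine (tab_genuine (r := 2) (![0, 1] : Fin 2 → Fin 2) (![0, 1] : Fin 2 → Fin 2)
    (by decide +revert) (by decide +revert) (by decide +revert) (by decide +revert)
    (![0, 1] : Fin 2 → Fin 2) (by decide +revert) (by decide +revert) (by decide +revert))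

theorem isCobordism_disks_addDot (x : Fin 4) : isCobordism 2 (disksSurf.addDot x).cls := by
  refine isCobordism_congr (isCobordism_disks (Pi.single x 1) (by decide +revert)) ?_
  refine Equivalent.of_bijective id Function.bijective_id (fun _ => rfl) (fun _ => rfl)
    Finsupp.mapDomain_id (Finsupp.mapDomain_id.trans ?_)
  refine Finsupp.ext fun y : Fin 4 => ?_
  change (Pi.single x 1 : Fin 4 → ℕ) y = (0 : ℕ) + Finsupp.single x 1 y
  rw [zero_add, Finsupp.single_apply, Pi.single_apply]
  exact if_congr eq_comm rfl rfl

/-- The edge `![0, 2] i` is a boundary edge on the `i`-th arc. -/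
theorem saddle_split : Equivalent (saddle (cupCap i) cupCapCircle (![0, 2] i)) (splitSurf i) :=
  saddle_tab ![(0 : Fin 2), 0, 1, 1, i, i] ![(0 : Fin 3), 0, 1, 1, 2, 2]
    (by decide +revert) (by decide +revert) (by decide +revert)
    (by decide +revert) (by decide +revert) (by decide +revert) _ _ _
    (by decide +revert) (by decide +revert) (by decide +revert) (by decide +revert)
    (by decide +revert) (by decide +revert)

theorem saddle_merge : Equivalent (saddle cupCapCircle (cupCap i) (![0, 2] i)) (mergeSurf i) :=
  saddle_tab ![(0 : Fin 3), 0, 1, 1, 2, 2] ![(0 : Fin 2), 0, 1, 1, i, i]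
    (by decide +revert) (by decide +revert) (by decide +revert)
    (by decide +revert) (by decide +revert) (by decide +revert) _ _ _
    (by decide +revert) (by decide +revert) (by decide +revert) (by decide +revert)
    (by decide +revert) (by decide +revert)

theorem saddle_saddleUp (e : Fin 6) : Equivalent (saddle (cupCap i) vertical e) (saddleUp i) :=
  saddle_tab ![(0 : Fin 2), 0, 1, 1, i, i] ![(0 : Fin 2), 1, 1, 0, 0, 1]
    (by decide +revert) (by decide +revert) (by decide +revert)
    (by decide +revert) (by decide +revert) (by decide +revert) _ _ _
    (by decide +revert) (by decide +revert) (by decide +revert) (by decide +revert)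
    (by decide +revert) (by decide +revert)

theorem saddle_saddleDown (e : Fin 6) : Equivalent (saddle vertical (cupCap i) e) (saddleDown i) :=
  saddle_tab ![(0 : Fin 2), 1, 1, 0, 0, 1] ![(0 : Fin 2), 0, 1, 1, i, i]
    (by decide +revert) (by decide +revert) (by decide +revert)
    (by decide +revert) (by decide +revert) (by decide +revert) _ _ _
    (by decide +revert) (by decide +revert) (by decide +revert) (by decide +revert)
    (by decide +revert) (by decide +revert)

theorem split_death : Equivalent (stack (splitSurf i) (deathSurf i)) (curtain (cupCap i).toDiag 0) :=
  (Surf.setoid _ _).trans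
    (stack_tab (m₃ := 2) (b₃ := id) (t₃ := id) (![0, 1] : Fin 2 → Fin 2) (![0, 1, i] : Fin 3 → Fin 2)
      (by decide +revert) (by decide +revert) (by decide +revert) (by decide +revert) (by decide +revert)
      (by decide +revert) (by decide +revert) (by decide +revert))
    ((Surf.setoid _ _).symm (curtain_tab (w := fun _ => rfl) (c := 1) (d := 0) 0
      (by decide +revert) fun _ => rfl))

theorem birth_merge : Equivalent (stack (birthSurf i) (mergeSurf i)) (curtain (cupCap i).toDiag 0) :=
  (Surf.setoid _ _).trans
    (stack_tab (m₃ := 2) (b₃ := id) (t₃ := id) (![0, 1, i] : Fin 3 → Fin 2) (![0, 1] : Fin 2 → Fin 2)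
      (by decide +revert) (by decide +revert) (by decide +revert) (by decide +revert) (by decide +revert)
      (by decide +revert) (by decide +revert) (by decide +revert))
    ((Surf.setoid _ _).symm (curtain_tab (w := fun _ => rfl) (c := 1) (d := 0) 0
      (by decide +revert) fun _ => rfl))

theorem birth_death : ∃ S : Surf (cupCap j).toDiag (cupCap i).toDiag,
    Equivalent (stack (birthSurf j) (deathSurf i)) (S.addSphere 0) :=
  ⟨tab (m := 2) (![0, 1] : Fin 2 → Fin 2) (![0, 1] : Fin 2 → Fin 2) (by decide +revert) 1 0,
    (Surf.setoid _ _).trans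
      (stack_tab (m₃ := 3) (b₃ := ![0, 1]) (t₃ := ![0, 1]) (w₃ := by decide +revert)
        (c₃ := ![1, 1, 2]) (d₃ := 0) (![0, 1, 2] : Fin 3 → Fin 3) (![0, 1, 2] : Fin 3 → Fin 3)
        (by decide +revert) (by decide +revert) (by decide +revert) (by decide +revert)
        (by decide +revert) (by decide +revert) (by decide +revert) (by decide +revert))
      ((Surf.setoid _ _).symm (addSphere_tab (m := 2) (r := 3) 0
        (fun x => x.elim 2 (![0, 1] : Fin 2 → Fin 3)) (by decide +revert) (by decide +revert)
        (by decide +revert) (by decide +revert) (by decide +revert) (by decide +revert)))⟩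

theorem death_saddleUp : Equivalent (stack (deathSurf i) (saddleUp i)) saddleDeath :=
  stack_tab (m₁ := 3) (m₂ := 1) (m₃ := 2) (![0, 0, 1] : Fin 3 → Fin 2) (![0] : Fin 1 → Fin 2)
    (by decide +revert) (by decide +revert) (by decide +revert) (by decide +revert)
    (by decide +revert) (by decide +revert) (by decide +revert) (by decide +revert)

theorem saddleDown_birth : Equivalent (stack (saddleDown i) (birthSurf i)) saddleBirth :=
  stack_tab (m₁ := 1) (m₂ := 3) (m₃ := 2) (![0] : Fin 1 → Fin 2) (![0, 0, 1] : Fin 3 → Fin 2)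
    (by decide +revert) (by decide +revert) (by decide +revert) (by decide +revert)
    (by decide +revert) (by decide +revert) (by decide +revert) (by decide +revert)

/-- Joining the two disks by a tube gives the identity of the circle. -/
theorem disks_tube_disks : Equivalent (disksSurf.addTube (2 : Fin 4) (3 : Fin 4))
    (curtain cupCapCircle.toDiag 0) :=
  (Surf.setoid _ _).trans
    (addTube_tab (m := 4) (r := 3) (b₃ := id) (t₃ := id) (w₃ := fun _ => rfl) (c₃ := ![1, 1, 0])
      (d₃ := 0) 2 3 (![0, 1, 2, 2] : Fin 4 → Fin 3)
      (by decide) (by decide) (by decide) (by decide) (by decide) (by decide) (by decide))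
    ((Surf.setoid _ _).symm (curtain_tab 0 (by decide) fun _ => rfl))

/-- The circle dies and another one splits off the `i`-th arc: a tube joins that arc and the disk
under the new circle. -/
theorem disks_tube_top : Equivalent (disksSurf.addTube (i.castLE (by decide) : Fin 4) (3 : Fin 4))
    (stack (deathSurf i) (splitSurf i)) :=
  (Surf.setoid _ _).trans
    (addTube_tab (m := 4) (r := 3) (b₃ := ![0, 1, 2]) (t₃ := ![0, 1, i.castLE (by decide)])
      (w₃ := by decide +revert) (c₃ := fun x => if x = i.castLE (by decide) then 0 else 1)
      (d₃ := 0) _ 3 (![0, 1, 2, i.castLE (by decide)] : Fin 4 → Fin 3)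
      (by decide +revert) (by decide +revert) (by decide +revert) (by decide +revert)
      (by decide +revert) (by decide +revert) (by decide +revert))
    ((Surf.setoid _ _).symm (stack_tab (m₁ := 3) (m₂ := 2) (![0, 1, 2] : Fin 3 → Fin 3)
      (![0, 1] : Fin 2 → Fin 3)
      (by decide +revert) (by decide +revert) (by decide +revert) (by decide +revert)
      (by decide +revert) (by decide +revert) (by decide +revert) (by decide +revert)))

/-- The circle merges into the `i`-th arc and another one is born: a tube joins that arc and the disk
over the old circle. -/
theorem disks_tube_bot : Equivalent (disksSurf.addTube (i.castLE (by decide) : Fin 4) (2 : Fin 4))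
    (stack (mergeSurf i) (birthSurf i)) :=
  (Surf.setoid _ _).trans
    (addTube_tab (m := 4) (r := 3) (b₃ := ![0, 1, i.castLE (by decide)]) (t₃ := ![0, 1, 2])
      (w₃ := by decide +revert) (c₃ := fun x => if x = i.castLE (by decide) then 0 else 1)
      (d₃ := 0) _ 2 (![0, 1, i.castLE (by decide), 2] : Fin 4 → Fin 3)
      (by decide +revert) (by decide +revert) (by decide +revert) (by decide +revert)
      (by decide +revert) (by decide +revert) (by decide +revert))
    ((Surf.setoid _ _).symm (stack_tab (m₁ := 2) (m₂ := 3) (![0, 1] : Fin 2 → Fin 3)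
      (![0, 1, 2] : Fin 3 → Fin 3)
      (by decide +revert) (by decide +revert) (by decide +revert) (by decide +revert)
      (by decide +revert) (by decide +revert) (by decide +revert) (by decide +revert)))

/-- Two saddles, while the circle dies and another one is born: a tube joins the two arcs. -/
theorem disks_tube_arcs : Equivalent (disksSurf.addTube (0 : Fin 4) (1 : Fin 4))
    (stack saddleDeath saddleBirth) :=
  (Surf.setoid _ _).trans
    (addTube_tab (m := 4) (r := 3) (b₃ := ![0, 0, 1]) (t₃ := ![0, 0, 2])
      (w₃ := by decide) (c₃ := ![0, 1, 1])
      (d₃ := 0) _ 1 (![0, 0, 1, 2] : Fin 4 → Fin 3)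
      (by decide) (by decide) (by decide) (by decide) (by decide) (by decide) (by decide))
    ((Surf.setoid _ _).symm (stack_tab (m₁ := 2) (m₂ := 2) (![0, 1] : Fin 2 → Fin 3)
      (![0, 2] : Fin 2 → Fin 3)
      (by decide) (by decide) (by decide) (by decide) (by decide) (by decide) (by decide)
      (by decide)))

theorem vertical_tube (w) : Equivalent ((tab (A := vertical.toDiag) (B := vertical.toDiag) (m := 2)
    id id w 1 0).addTube (0 : Fin 2) (1 : Fin 2)) (stack (saddleDown i) (saddleUp i)) :=
  (Surf.setoid _ _).trans
    (addTube_tab (m := 2) (r := 1) (b₃ := ![0, 0]) (t₃ := ![0, 0])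
      (w₃ := by decide) (c₃ := 0)
      (d₃ := 0) _ 1 (![0, 0] : Fin 2 → Fin 1)
      (by decide) (by decide) (by decide) (by decide) (by decide) (by decide) (by decide))
    ((Surf.setoid _ _).symm (stack_tab (m₁ := 1) (m₂ := 1) (![0] : Fin 1 → Fin 1)
      (![0] : Fin 1 → Fin 1)
      (by decide +revert) (by decide +revert) (by decide +revert) (by decide +revert)
      (by decide +revert) (by decide +revert) (by decide +revert) (by decide +revert)))

theorem saddleDeath_tube : Equivalent (saddleDeath.addTube (0 : Fin 2) (1 : Fin 2))
    (stack (mergeSurf i) (saddleUp i)) :=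
  (Surf.setoid _ _).trans
    (addTube_tab (m := 2) (r := 1) (b₃ := ![0, 0, 0]) (t₃ := ![0, 0])
      (w₃ := by decide) (c₃ := 0)
      (d₃ := 0) _ 1 (![0, 0] : Fin 2 → Fin 1)
      (by decide) (by decide) (by decide) (by decide) (by decide) (by decide) (by decide))
    ((Surf.setoid _ _).symm (stack_tab (m₁ := 2) (m₂ := 1) (![0, 0] : Fin 2 → Fin 1)
      (![0] : Fin 1 → Fin 1)
      (by decide +revert) (by decide +revert) (by decide +revert) (by decide +revert)
      (by decide +revert) (by decide +revert) (by decide +revert) (by decide +revert)))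

theorem unforget_forget : Equivalent (stack unforgetSurf forgetSurf) (curtain straight.toDiag 0) :=
  (Surf.setoid _ _).trans
    (stack_tab (m₁ := 2) (m₂ := 2) (m₃ := 2) (b₃ := id) (t₃ := id) (w₃ := fun _ => rfl) (c₃ := 1)
      (d₃ := 0) (![0, 1] : Fin 2 → Fin 2) (![0, 1] : Fin 2 → Fin 2)
      (by decide) (by decide) (by decide) (by decide) (by decide) (by decide) (by decide)
      (by decide))
    ((Surf.setoid _ _).symm (curtain_tab 0 (by decide) fun _ => rfl))

theorem forget_unforget : Equivalent (stack forgetSurf unforgetSurf) (curtain vertical.toDiag 0) :=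
  (Surf.setoid _ _).trans
    (stack_tab (m₁ := 2) (m₂ := 2) (m₃ := 2) (b₃ := id) (t₃ := id) (w₃ := fun _ => rfl) (c₃ := 1)
      (d₃ := 0) (![0, 1] : Fin 2 → Fin 2) (![0, 1] : Fin 2 → Fin 2)
      (by decide) (by decide) (by decide) (by decide) (by decide) (by decide) (by decide)
      (by decide))
    ((Surf.setoid _ _).symm (curtain_tab 0 (by decide) fun _ => rfl))

end

/-! ### Dots -/

section

variable {n : ℕ} {E : Type} {bd : Fin (2 * n) → E}

theorem dot_stack {B : Diag n} (A : Marked bd) (e : E) (S : Surf A.toDiag B) :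
    Equivalent (stack (A.dotSurf e) S) (S.addDot (S.bot (A.lab e))) := by
  refine (Surf.setoid _ _).trans (curtain_stack _ _) ?_
  rw [Finsupp.mapDomain_single, add_comm]
  exact (Surf.setoid _ _).refl _

theorem stack_dot {B : Diag n} (A : Marked bd) (e : E) (S : Surf B A.toDiag) :
    Equivalent (stack S (A.dotSurf e)) (S.addDot (S.top (A.lab e))) := by
  refine (Surf.setoid _ _).trans (stack_curtain _ _) ?_
  rw [Finsupp.mapDomain_single]
  exact (Surf.setoid _ _).refl _

theorem isCobordism_dotSurf (A : Marked bd) (e : E) : isCobordism n (A.dotSurf e).cls :=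
  isCobordism_of_genuine (curtain_genuine _ _)

theorem isCobordism_curtain (A : Diag n) : isCobordism n (curtain A 0).cls :=
  isCobordism_of_genuine (curtain_genuine _ _)

/-- The morphism `Marked.dotCob`, with its source and target written as a graded diagram. -/
def Cob.dotHom (A : Marked bd) (q : ℤ) (e : E) :
    Cob.of (⟨q, A.toDiag⟩ : QDiag n) ⟶ Cob.of ⟨q, A.toDiag⟩ := A.dotCob q e

/-- A dot moves along the sheet which contains it. -/
theorem dotCob_mkSurf {F : Type} {bd' : Fin (2 * n) → F} (A : Marked bd) (B : Marked bd')
    (S : Surf A.toDiag B.toDiag) (h : isCobordism n S.cls) (q q' : ℤ) (e : E) (e' : F)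
    (he : S.bot (A.lab e) = S.top (B.lab e')) :
    Cob.dotHom A q e ≫ Cob.mkSurf q q' S h = Cob.mkSurf q q' S h ≫ Cob.dotHom B q' e' := by
  have hU := isCobordism_stack (isCobordism_dotSurf A e) h (dot_stack A e S)
  refine (Cob.mkSurf_comp (isCobordism_dotSurf A e) h hU (dot_stack A e S)).trans
    (Cob.mkSurf_comp h (isCobordism_dotSurf B e') hU ?_).symm
  rw [he]
  exact stack_dot B e' S

/-- Neck cutting between two sheets marked by an edge at the bottom and an edge at the top. -/
theorem mkSurf_neck_dotCob {F : Type} {bd' : Fin (2 * n) → F} (A : Marked bd) (B : Marked bd')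
    (S U : Surf A.toDiag B.toDiag) (h : isCobordism n S.cls) (hU : isCobordism n U.cls) (q q' : ℤ)
    (e : E) (e' : F) (he : Equivalent (S.addTube (S.top (B.lab e')) (S.bot (A.lab e))) U) :
    Cob.mkSurf q q' U hU
      = Cob.mkSurf q q' S h ≫ Cob.dotHom B q' e' + Cob.dotHom A q e ≫ Cob.mkSurf q q' S h := by
  refine (Cob.mkSurf_neck _ _ he hU
    (isCobordism_stack h (isCobordism_dotSurf B e') (stack_dot B e' S))
    (isCobordism_stack (isCobordism_dotSurf A e) h (dot_stack A e S))).trans ?_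
  exact congrArg₂ (· + ·)
    (Cob.mkSurf_comp h (isCobordism_dotSurf B e') _ (stack_dot B e' S)).symm
    (Cob.mkSurf_comp (isCobordism_dotSurf A e) h _ (dot_stack A e S)).symm

theorem mkSurf_stack {A B C : Diag n} {q q' q'' : ℤ} {S : Surf A B} {T : Surf B C}
    (hS : isCobordism n S.cls) (hT : isCobordism n T.cls) :
    Cob.mkSurf q q' S hS ≫ Cob.mkSurf q' q'' T hT
      = Cob.mkSurf q q'' (stack S T) (isCobordism_stack hS hT ((Surf.setoid _ _).refl _)) :=
  Cob.mkSurf_comp hS hT _ ((Surf.setoid _ _).refl _)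

theorem mkSurf_comp_eq_id {A B : Diag n} {q q' : ℤ} {S : Surf A B} {T : Surf B A}
    (hS : isCobordism n S.cls) (hT : isCobordism n T.cls)
    (e : Equivalent (stack S T) (curtain A 0)) :
    Cob.mkSurf q q' S hS ≫ Cob.mkSurf q' q T hT = 𝟙 (Cob.of (⟨q, A⟩ : QDiag n)) :=
  (Cob.mkSurf_comp hS hT (isCobordism_curtain A) e).trans
    (Cob.id_eq_mkSurf (isCobordism_curtain A)).symm

end

/-- The neck between the two arcs of a diagram without circles is cut into the sum of the dots on the
arcs. -/
theorem neck_arcs {k : ℕ} {bd : Fin (2 * 2) → Fin k} (t : Fin k → Fin 2) (hs hf hn)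
    {U : Surf (ofTable bd t hs hf hn).toDiag (ofTable bd t hs hf hn).toDiag} {w}
    (hU : isCobordism 2 U.cls) (q : ℤ) (e e' : Fin k) (he : t e = 1) (he' : t e' = 0)
    (ht : ∀ x, (if Fintype.card {p // t (bd p) = x} = 2 then (1 : ℤ) else 0) = 1)
    (h : Equivalent ((tab (A := (ofTable bd t hs hf hn).toDiag)
      (B := (ofTable bd t hs hf hn).toDiag) (m := 2) id id w 1 0).addTube (0 : Fin 2) (1 : Fin 2)) U) :
    Cob.mkSurf q q U hU = Cob.dotHom (ofTable bd t hs hf hn) q e' + Cob.dotHom (ofTable bd t hs hf hn) q e := by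
  let S := tab (A := (ofTable bd t hs hf hn).toDiag)
      (B := (ofTable bd t hs hf hn).toDiag) (m := 2) id id w 1 0
  have hid : Equivalent S (curtain (ofTable bd t hs hf hn).toDiag 0) :=
    (Surf.setoid _ _).symm (curtain_tab (fA := (ofTable bd t hs hf hn).fiber)
      (nA := (ofTable bd t hs hf hn).noncross) 0 ht fun _ => rfl)
  have hc := isCobordism_congr (isCobordism_curtain _) ((Surf.setoid _ _).symm hid)
  have key : Cob.mkSurf q q _ hc = 𝟙 (Cob.of ⟨q, (ofTable bd t hs hf hn).toDiag⟩) :=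
    (Cob.mkSurf_congr hc (isCobordism_curtain _) hid).trans
      (Cob.id_eq_mkSurf (isCobordism_curtain _)).symm
  have h' := mkSurf_neck_dotCob (ofTable bd t hs hf hn) (ofTable bd t hs hf hn) S U hc hU q q e e' (by
    exact (congrArg₂ (fun x y : Fin 2 => Equivalent (S.addTube x y) U) he' he).mpr h)
  rw [h', key]
  exact congrArg₂ (· + ·) (Category.id_comp _) (Category.comp_id _)

/-! ### Relations between the cobordisms of the second Reidemeister move -/

section

variable (i j : Fin 2) (q q' q'' : ℤ)

/-- The cup and cap with the middle edges on the `i`-th arc, with a `q`-degree. -/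
abbrev obCupCap : Cob 2 := Cob.of ⟨q, (cupCap i).toDiag⟩
/-- The resolution with a circle, with a `q`-degree. -/
abbrev obCircle : Cob 2 := Cob.of ⟨q, cupCapCircle.toDiag⟩
/-- The vertical resolution, with a `q`-degree. -/
abbrev obVertical : Cob 2 := Cob.of ⟨q, vertical.toDiag⟩
/-- The diagram without crossings, with a `q`-degree. -/
abbrev obStraight : Cob 2 := Cob.of ⟨q, straight.toDiag⟩

/-- The morphism `splitSurf` of the dotted cobordism category. -/
def splitHom : obCupCap i q ⟶ obCircle q' := Cob.mkSurf _ _ (splitSurf i) (isCobordism_split i)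
/-- The morphism `mergeSurf` of the dotted cobordism category. -/
def mergeHom : obCircle q ⟶ obCupCap i q' := Cob.mkSurf _ _ (mergeSurf i) (isCobordism_merge i)
/-- The morphism `saddleUp` of the dotted cobordism category. -/
def upHom : obCupCap i q ⟶ obVertical q' := Cob.mkSurf _ _ (saddleUp i) (isCobordism_saddleUp i)
/-- The morphism `saddleDown` of the dotted cobordism category. -/
def downHom : obVertical q ⟶ obCupCap i q' :=
  Cob.mkSurf _ _ (saddleDown i) (isCobordism_saddleDown i)
/-- The morphism `deathSurf` of the dotted cobordism category. -/
def deathHom : obCircle q ⟶ obCupCap i q' := Cob.mkSurf _ _ (deathSurf i) (isCobordism_death i)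
/-- The morphism `birthSurf` of the dotted cobordism category. -/
def birthHom : obCupCap i q ⟶ obCircle q' := Cob.mkSurf _ _ (birthSurf i) (isCobordism_birth i)
/-- The morphism `forgetSurf` of the dotted cobordism category. -/
def forgetHom : obVertical q ⟶ obStraight q' := Cob.mkSurf _ _ forgetSurf isCobordism_forget
/-- The morphism `unforgetSurf` of the dotted cobordism category. -/
def unforgetHom : obStraight q ⟶ obVertical q' := Cob.mkSurf _ _ unforgetSurf isCobordism_unforget

theorem isCobordism_saddleDeath : isCobordism 2 saddleDeath.cls :=
  isCobordism_stack (isCobordism_death 0) (isCobordism_saddleUp 0) (death_saddleUp 0)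

theorem isCobordism_saddleBirth : isCobordism 2 saddleBirth.cls :=
  isCobordism_stack (isCobordism_saddleDown 0) (isCobordism_birth 0) (saddleDown_birth 0)

theorem split_comp_death : splitHom i q q' ≫ deathHom i q' q = 𝟙 _ :=
  mkSurf_comp_eq_id _ _ (split_death i)

theorem birth_comp_merge : birthHom i q q' ≫ mergeHom i q' q = 𝟙 _ :=
  mkSurf_comp_eq_id _ _ (birth_merge i)

theorem forget_comp_unforget : forgetHom q q' ≫ unforgetHom q' q = 𝟙 _ :=
  mkSurf_comp_eq_id _ _ forget_unforget

theorem unforget_comp_forget : unforgetHom q q' ≫ forgetHom q' q = 𝟙 _ :=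
  mkSurf_comp_eq_id _ _ unforget_forget

/-- A circle which is born and dies is a sphere without dots. -/
theorem birth_comp_death : birthHom j q q' ≫ deathHom i q' q'' = 0 := by
  obtain ⟨S, hS⟩ := birth_death i j
  exact (mkSurf_stack _ _).trans (Cob.mkSurf_sphere ((Surf.setoid _ _).symm hS) _)

theorem death_comp_up : deathHom i q q' ≫ upHom i q' q''
    = Cob.mkSurf q q'' saddleDeath isCobordism_saddleDeath :=
  Cob.mkSurf_comp _ _ _ (death_saddleUp i)

theorem down_comp_birth : downHom i q q' ≫ birthHom i q' q''
    = Cob.mkSurf q q'' saddleBirth isCobordism_saddleBirth :=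
  Cob.mkSurf_comp _ _ _ (saddleDown_birth i)

/-- The identity of the diagram with a circle, up to homotopy. All four summands arise by attaching a
tube to `disksSurf`, and by neck cutting both sides are the sum of the four ways to put a dot on it. -/
theorem circle_relation (hij : i ≠ j) (p : ℤ) :
    𝟙 (obCircle q) + (deathHom i q q' ≫ upHom i q' p) ≫ downHom j p q'' ≫ birthHom j q'' q
      = deathHom i q q' ≫ splitHom i q' q + mergeHom j q q'' ≫ birthHom j q'' q := by
  have h0 := Cob.id_eq_mkSurf (q := q) (isCobordism_curtain cupCapCircle.toDiag)
  rw [Cob.mkSurf_neck (q := q) (q' := q) _ _ disks_tube_disks _ (isCobordism_disks_addDot 2)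
    (isCobordism_disks_addDot 3)] at h0
  have h1 : deathHom i q q' ≫ splitHom i q' q = _ := (mkSurf_stack _ _).trans
    (Cob.mkSurf_neck _ _ (disks_tube_top i) _ (isCobordism_disks_addDot _)
    (isCobordism_disks_addDot 3))
  have h2 : mergeHom j q q'' ≫ birthHom j q'' q = _ := (mkSurf_stack _ _).trans
    (Cob.mkSurf_neck _ _ (disks_tube_bot j) _ (isCobordism_disks_addDot _)
    (isCobordism_disks_addDot 2))
  have h3 : (deathHom i q q' ≫ upHom i q' p) ≫ downHom j p q'' ≫ birthHom j q'' q = _ :=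
    (congrArg₂ _ (death_comp_up i q q' p) (down_comp_birth j p q'' q)).trans
    ((mkSurf_stack _ _).trans (Cob.mkSurf_neck _ _ disks_tube_arcs _ (isCobordism_disks_addDot 0)
    (isCobordism_disks_addDot 1)))
  rw [h0, h1, h2, h3]
  have key : ∀ X : Fin 4 → (obCircle q ⟶ obCircle q), X 2 + X 3 + (X 0 + X 1)
      = X (i.castLE (by decide)) + X 3 + (X (j.castLE (by decide)) + X 2) := by
    intro X
    have h : ∀ i j : Fin 2, i ≠ j → (i = 0 ∧ j = 1) ∨ (i = 1 ∧ j = 0) := by decide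
    rcases h i j hij with ⟨rfl, rfl⟩ | ⟨rfl, rfl⟩
    · change _ = X 0 + X 3 + (X 1 + X 2)
      abel
    · change _ = X 1 + X 3 + (X 0 + X 2)
      abel
  exact key fun x => Cob.mkSurf q q (disksSurf.addDot x) (isCobordism_disks_addDot x)

/-- Merging the circle into an arc and then applying the reversed saddle is a tube between the
disk on the circle and the saddle. -/
theorem merge_comp_up (p : ℤ) (e e' : Fin 6) (he : cupCapCircle.lab e = (2 : Fin 3)) :
    mergeHom j q q' ≫ upHom j q' q'' = (deathHom i q p ≫ upHom i p q'') ≫ Cob.dotHom vertical q'' e'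
      + Cob.dotHom cupCapCircle q e ≫ deathHom i q p ≫ upHom i p q'' := by
  rw [death_comp_up]
  refine (mkSurf_stack _ _).trans (mkSurf_neck_dotCob cupCapCircle vertical saddleDeath _ _ _ _ _
    e e' ?_)
  have h1 : saddleDeath.bot (cupCapCircle.lab e) = (1 : Fin 2) := by rw [he]; rfl
  have h2 : saddleDeath.top (vertical.lab e') = (0 : Fin 2) :=
    (show ∀ x : Fin 2, (![0, 0] : Fin 2 → Fin 2) x = 0 by decide) (vertical.lab e')
  rw [h1, h2]
  exact saddleDeath_tube j

/-- The saddle followed by the reversed saddle is a tube between the two vertical strands. -/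
theorem down_comp_up (e e' : Fin 6) (he : vertical.lab e = (1 : Fin 2))
    (he' : vertical.lab e' = (0 : Fin 2)) :
    downHom j q q' ≫ upHom j q' q = Cob.dotHom vertical q e' + Cob.dotHom vertical q e :=
  (mkSurf_stack _ _).trans (neck_arcs _ _ (by decide) _ _ q e e' he he' (by decide)
    (vertical_tube j fun _ => rfl))

theorem dot_comp_forget (e : Fin 6) (e' : Fin 4)
    (he : vertical.lab e = (straight.lab e' : Fin 2)) :
    Cob.dotHom vertical q e ≫ forgetHom q q' = forgetHom q q' ≫ Cob.dotHom straight q' e' := by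
  refine dotCob_mkSurf _ _ _ _ _ _ _ _ ?_
  rw [he]
  rfl

theorem saddle_oneCrossing (s : Smoothing) (e : Fin 4) : ∃ w, Equivalent
    (saddle (oneCrossing s) (oneCrossing s.swap) e)
    (tab (m := 1) (fun _ => 0) (fun _ => 0) w 1 0) := by
  cases s
  · exact ⟨fun _ => rfl, saddle_tab ![(0 : Fin 2), 1, 1, 0] ![(0 : Fin 2), 0, 1, 1] (by decide)
      (by decide) (by decide) (by decide) (by decide) (by decide) e _ _
      (by decide) (by decide) (by decide) (by decide) (by decide +revert) (by decide)⟩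
  · exact ⟨fun _ => rfl, saddle_tab ![(0 : Fin 2), 0, 1, 1] ![(0 : Fin 2), 1, 1, 0] (by decide)
      (by decide) (by decide) (by decide) (by decide) (by decide) e _ _
      (by decide) (by decide) (by decide) (by decide) (by decide +revert) (by decide)⟩

theorem saddle_oneCrossing_swap (s : Smoothing) (e : Fin 4) : ∃ w, Equivalent
    (saddle (oneCrossing s.swap) (oneCrossing s) e)
    (tab (m := 1) (fun _ => 0) (fun _ => 0) w 1 0) := by
  cases s
  · exact saddle_oneCrossing .horiz e
  · exact saddle_oneCrossing .vert e

theorem saddle_oneCrossing_stack (s : Smoothing) (e e' : Fin 4) : Equivalent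
    (stack (saddle (oneCrossing s) (oneCrossing s.swap) e)
      (saddle (oneCrossing s.swap) (oneCrossing s) e'))
    (tab (m := 1) (fun _ => 0) (fun _ => 0) (fun _ => rfl) 0 0) := by
  obtain ⟨w, h1⟩ := saddle_oneCrossing s e
  obtain ⟨w', h2⟩ := saddle_oneCrossing_swap s e'
  refine (Surf.setoid _ _).trans (stack_congr h1 h2) ?_
  cases s
  all_goals
    exact stack_tab (m₃ := 1) (b₃ := fun _ => 0) (t₃ := fun _ => 0) (w₃ := fun _ => rfl) (c₃ := 0)
        (d₃ := 0) id id (by decide) (by decide) (by decide) (by decide) (by decide) (by decide)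
        (by decide) (by decide)

/-- A saddle at a crossing followed by the reversed saddle is the sum of the dots on the two arcs of
the resolution. -/
theorem saddleCob_comp_saddleCob (s : Smoothing) (e e' : Fin 4) (h h')
    (he : (oneCrossing s).lab e ≠ (oneCrossing s).lab e') :
    saddleCob (oneCrossing s) (oneCrossing s.swap) 0 h q q'
      ≫ saddleCob (oneCrossing s.swap) (oneCrossing s) 0 h' q' q
      = Cob.dotHom (oneCrossing s) q e + Cob.dotHom (oneCrossing s) q e' := by
  have fin2 : ∀ x y : Fin 2, x ≠ y → (x = 1 ∧ y = 0) ∨ (y = 1 ∧ x = 0) := by decide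
  have hst := saddle_oneCrossing_stack s 0 0
  cases s
  · have aux : ∀ e e' : Fin 4, (oneCrossing .vert).lab e = (1 : Fin 2) →
        (oneCrossing .vert).lab e' = (0 : Fin 2) →
        saddleCob (oneCrossing .vert) (oneCrossing .horiz) 0 h q q'
          ≫ saddleCob (oneCrossing .horiz) (oneCrossing .vert) 0 h' q' q
          = Cob.dotHom (oneCrossing .vert) q e' + Cob.dotHom (oneCrossing .vert) q e := fun e e' he he' =>
      (mkSurf_stack (isCobordism_of_genuine h) (isCobordism_of_genuine h')).trans
      (neck_arcs (bd := ends 4 le_rfl) ![0, 1, 1, 0] (by decide) (by decide) (by decide)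
        (w := fun _ => rfl) _ q e e' he he' (by decide)
        ((Surf.setoid _ _).trans (addTube_tab (m := 2) (r := 1) 0 1 (fun _ => 0) (by decide)
          (by decide) (by decide) (by decide) (by decide) (by decide) (by decide))
          ((Surf.setoid _ _).symm hst)))
    rcases fin2 _ _ he with ⟨h1, h2⟩ | ⟨h1, h2⟩
    · exact (aux e e' h1 h2).trans (add_comm _ _)
    · exact aux e' e h1 h2
  · have aux : ∀ e e' : Fin 4, (oneCrossing .horiz).lab e = (1 : Fin 2) →
        (oneCrossing .horiz).lab e' = (0 : Fin 2) →
        saddleCob (oneCrossing .horiz) (oneCrossing .vert) 0 h q q'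
          ≫ saddleCob (oneCrossing .vert) (oneCrossing .horiz) 0 h' q' q
          = Cob.dotHom (oneCrossing .horiz) q e' + Cob.dotHom (oneCrossing .horiz) q e := fun e e' he he' =>
      (mkSurf_stack (isCobordism_of_genuine h) (isCobordism_of_genuine h')).trans
      (neck_arcs (bd := ends 4 le_rfl) ![0, 0, 1, 1] (by decide) (by decide) (by decide)
        (w := fun _ => rfl) _ q e e' he he' (by decide)
        ((Surf.setoid _ _).trans (addTube_tab (m := 2) (r := 1) 0 1 (fun _ => 0) (by decide)
          (by decide) (by decide) (by decide) (by decide) (by decide) (by decide))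
          ((Surf.setoid _ _).symm hst)))
    rcases fin2 _ _ he with ⟨h1, h2⟩ | ⟨h1, h2⟩
    · exact (aux e e' h1 h2).trans (add_comm _ _)
    · exact aux e' e h1 h2

theorem saddleCob_eq_split (h) : saddleCob (cupCap i) cupCapCircle (![0, 2] i) h q q'
    = splitHom i q q' := Cob.mkSurf_congr _ _ (saddle_split i)

theorem saddleCob_eq_merge (h) : saddleCob cupCapCircle (cupCap i) (![0, 2] i) h q q'
    = mergeHom i q q' := Cob.mkSurf_congr _ _ (saddle_merge i)

theorem saddleCob_eq_up (e) (h) : saddleCob (cupCap i) vertical e h q q' = upHom i q q' :=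
  Cob.mkSurf_congr _ _ (saddle_saddleUp i e)

theorem saddleCob_eq_down (e) (h) : saddleCob vertical (cupCap i) e h q q' = downHom i q q' :=
  Cob.mkSurf_congr _ _ (saddle_saddleDown i e)

end

/-! ### Chain maps and homotopies between complexes spread over finite sets -/

namespace CubeData

variable {C : Type 1} [Category.{1} C] [Preadditive C] (K L : CubeData C)

/-- A chain map given by a matrix of morphisms between the vertices. -/
def matrixMap (φ : ∀ v w, K.obj v ⟶ L.obj w) (h0 : ∀ v w, K.wt v ≠ L.wt w → φ v w = 0)
    (hφ : ∀ v w, ∑ u, φ v u ≫ L.edge u w = ∑ u, K.edge v u ≫ φ u w) : K.complex ⟶ L.complex where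
  f _ := fun v w => φ v.1 w.1
  comm' i j hij := by
    refine Mat_.hom_ext _ _ fun v w => ?_
    refine (L.sum_weight i (fun u => φ v.1 u ≫ L.edge u w.1) fun u hu => ?_).trans
      ((hφ v.1 w.1).trans (K.sum_weight j (fun u => K.edge v.1 u ≫ φ u w.1) fun u hu => ?_).symm)
    · rw [h0 _ _ fun h => hu (h.symm.trans v.2), Limits.zero_comp]
    · rw [h0 _ _ fun h => hu (h.trans w.2), Limits.comp_zero]

variable {K L}

/-- A chain homotopy given by a matrix of morphisms between the vertices. -/
def matrixHomotopy {f g : K.complex ⟶ L.complex} (φ ψ h : ∀ v w, K.obj v ⟶ L.obj w)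
    (hf : ∀ i v w, f.f i v w = φ v.1 w.1) (hg : ∀ i v w, g.f i v w = ψ v.1 w.1)
    (h0 : ∀ v w, L.wt w + 1 ≠ K.wt v → h v w = 0)
    (hh : ∀ v w, K.wt v = L.wt w →
      φ v w = ∑ u, K.edge v u ≫ h u w + ∑ u, h v u ≫ L.edge u w + ψ v w) : Homotopy f g where
  hom _ _ := fun v w => h v.1 w.1
  zero i j hij := by
    refine Mat_.hom_ext _ _ fun v w => h0 _ _ fun e => hij ?_
    rw [v.2, w.2] at e
    exact e
  comm i := by
    let H : ∀ i j, K.complex.X i ⟶ L.complex.X j := fun _ _ v w => h v.1 w.1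
    refine Eq.trans ?_ (congrArg (· + g.f i) (congrArg₂ (· + ·)
      (dNext_eq H (show (ComplexShape.up ℤ).Rel i (i + 1) from rfl)).symm
      (prevD_eq H (show (ComplexShape.up ℤ).Rel (i - 1) i from sub_add_cancel i 1)).symm))
    refine Mat_.hom_ext _ _ fun v w => ?_
    refine (hf i v w).trans ((hh v.1 w.1 (v.2.trans w.2.symm)).trans ?_)
    refine congrArg₂ (· + ·) (congrArg₂ (· + ·) ?_ ?_) (hg i v w).symm
    · refine (K.sum_weight (i + 1) (fun u => K.edge v.1 u ≫ h u w.1) fun u hu => ?_).symm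
      rw [h0 _ _ fun e => hu (by rw [← e, w.2]), Limits.comp_zero]
    · refine (L.sum_weight (i - 1) (fun u => h v.1 u ≫ L.edge u w.1) fun u hu => ?_).symm
      rw [h0 _ _ fun e => hu (by rw [v.2] at e; omega), Limits.zero_comp]

theorem id_apply (i : ℤ) (v w : {v : K.V // K.wt v = i}) :
    (𝟙 K.complex : K.complex ⟶ K.complex).f i v w = K.diagonal (fun _ => 𝟙 _) v.1 w.1 := by
  change (𝟙 (K.complex.X i) : K.complex.X i ⟶ K.complex.X i) v w = _
  by_cases h : v = w
  · subst h
    rw [diagonal_self]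
    exact Mat_.id_apply_self _ _
  · rw [K.diagonal_ne _ fun e => h (Subtype.ext e)]
    exact Mat_.id_apply_of_ne _ _ _ h

theorem comp_apply {M : CubeData C} (f : K.complex ⟶ L.complex) (g : L.complex ⟶ M.complex)
    (φ : ∀ v w, K.obj v ⟶ L.obj w) (ψ : ∀ v w, L.obj v ⟶ M.obj w)
    (hf : ∀ i v w, f.f i v w = φ v.1 w.1) (hg : ∀ i v w, g.f i v w = ψ v.1 w.1)
    (h0 : ∀ v w, K.wt v ≠ L.wt w → φ v w = 0) (i : ℤ) (v w) :
    (f ≫ g).f i v w = ∑ u, φ v.1 u ≫ ψ u w.1 := by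
  refine Eq.trans ?_ (L.sum_weight i (fun u => φ v.1 u ≫ ψ u w.1) fun u hu => ?_)
  · exact Finset.sum_congr rfl fun u _ => congrArg₂ _ (hf i v u) (hg i u w)
  · rw [h0 _ _ fun h => hu (h.symm.trans v.2), Limits.zero_comp]

end CubeData

theorem HomotopicInDegree.zsmul {n : ℕ} {K L : Kom n} {d : ℤ} {f g : K ⟶ L}
    (h : HomotopicInDegree d f g) (m : ℤ) : HomotopicInDegree d (m • f) (m • g) := by
  obtain ⟨h, hh⟩ := h
  refine ⟨{ hom := fun i j => m • h.hom i j, zero := fun i j hij => ?_, comm := fun i => ?_ },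
    fun i j v w => (hh i j v w).zsmul m⟩
  · rw [h.zero i j hij, smul_zero]
  · rw [HomologicalComplex.zsmul_f_apply, HomologicalComplex.zsmul_f_apply, h.comm i]
    simp [dNext, prevD, smul_add]

/-! ### Dots slide through a crossing -/

theorem oneCrossing_genuine_swap (s : Smoothing) :
    (saddle (oneCrossing s.swap) (oneCrossing s) 0).Genuine := by
  cases s
  · exact oneCrossing_genuine .horiz
  · exact oneCrossing_genuine .vert

theorem saddleCob_swap_comp_saddleCob (q q' : ℤ) (s : Smoothing) (e e' : Fin 4) (h h')
    (he : (oneCrossing s.swap).lab e ≠ (oneCrossing s.swap).lab e') :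
    saddleCob (oneCrossing s.swap) (oneCrossing s) 0 h q q'
      ≫ saddleCob (oneCrossing s) (oneCrossing s.swap) 0 h' q' q
      = Cob.dotHom (oneCrossing s.swap) q e + Cob.dotHom (oneCrossing s.swap) q e' := by
  cases s
  · exact saddleCob_comp_saddleCob q q' .horiz e e' h h' he
  · exact saddleCob_comp_saddleCob q q' .vert e e' h h' he

/-- The reversed saddle, as a matrix between the two resolutions of a crossing. -/
def crossingHomotopy (s : Smoothing) (c : CrossingSign) : ∀ v w : Bool,
    (crossing s c).obj v ⟶ (crossing s c).obj w
  | true, false => saddleCob (oneCrossing s.swap) (oneCrossing s) 0 (oneCrossing_genuine_swap s) _ _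
  | _, _ => 0

theorem isHomogeneous_saddle_oneCrossing (s : Smoothing) (h) (q q' : ℤ) :
    Cob.IsHomogeneous (q' - q - 1) (saddleCob (oneCrossing s.swap) (oneCrossing s) 0 h q q') := by
  obtain ⟨w, hw⟩ := saddle_oneCrossing_swap s 0
  have h' := isCobordism_congr (isCobordism_of_genuine h) hw
  have := Cob.isHomogeneous_tab (q := q) (q' := q') (A := (oneCrossing s.swap).toDiag)
    (B := (oneCrossing s).toDiag) (d := q' - q - 1) _ _ h' (by simp; ring)
  rwa [← Cob.mkSurf_congr (isCobordism_of_genuine h) h' hw] at this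

theorem crossingDot_homotopic (s : Smoothing) (c : CrossingSign) (e e' : Fin 4)
    (h : ∀ s, (oneCrossing s).lab e ≠ (oneCrossing s).lab e') :
    HomotopicInDegree (-2) (crossingDot s c e) (-crossingDot s c e') := by
  let K := crossing s c
  let D := fun e v w => K.diagonal (fun v => (oneCrossing (s.resolve v)).dotCob _ e) v w
  refine ⟨CubeData.matrixHomotopy (D e) (fun v w => -D e' v w)
    (crossingHomotopy s c) (fun _ _ _ => rfl) (fun _ _ _ => rfl) ?_ ?_, ?_⟩
  · intro v w hvw
    cases v <;> cases w <;> first | rfl | exact absurd (by simp only [crossing, bit]; ring1) hvw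
  · intro v w hvw
    have hvw' : v = w := by
      have : bit v + c.homShift = bit w + c.homShift := hvw
      cases v <;> cases w <;> first | rfl | simp [bit] at this
    subst hvw'
    refine eq_add_neg_of_add_eq ((congrArg₂ (· + ·) (K.diagonal_self _ v)
      (K.diagonal_self _ v)).trans ?_)
    change Bool at v
    refine Eq.trans ?_ (congrArg₂ (· + ·) (Fintype.sum_bool _).symm (Fintype.sum_bool _).symm)
    cases v
    · refine (saddleCob_comp_saddleCob _ (bit true + c.qShift) s e e' (oneCrossing_genuine s)
        (oneCrossing_genuine_swap s) (h _)).symm.trans ?_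
      refine Eq.trans ?_ (congrArg₂ (· + ·) (congrArg₂ (· + ·) rfl Limits.zero_comp.symm)
        (congrArg₂ (· + ·) Limits.zero_comp.symm Limits.comp_zero.symm))
      exact ((congrArg₂ (· + ·) (add_zero _) (add_zero _)).trans (add_zero _)).symm
    · refine (saddleCob_swap_comp_saddleCob _ (bit false + c.qShift) s e e' (oneCrossing_genuine_swap s)
        (oneCrossing_genuine s) (h _)).symm.trans ?_
      refine Eq.trans ?_ (congrArg₂ (· + ·) (congrArg₂ (· + ·) Limits.zero_comp.symm
        Limits.zero_comp.symm) (congrArg₂ (· + ·) Limits.zero_comp.symm rfl))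
      exact ((congrArg₂ (· + ·) (add_zero _) (zero_add _)).trans (zero_add _)).symm
  · intro i j v w
    change Cob.IsHomogeneous (-2) (crossingHomotopy s c v.1 w.1)
    obtain ⟨v, -⟩ := v
    obtain ⟨w, -⟩ := w
    cases v <;> cases w
    · exact Cob.IsHomogeneous.zero
    · exact Cob.IsHomogeneous.zero
    · refine Eq.mp ?_ (isHomogeneous_saddle_oneCrossing s (oneCrossing_genuine_swap s)
        (bit true + c.qShift) (bit false + c.qShift))
      refine congrArg (fun d => Cob.IsHomogeneous d _) ?_
      simp only [bit]; ring
    · exact Cob.IsHomogeneous.zero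

/-! ### Squares -/

/-- A complex spread over the square `Bool × Bool`, in degrees `-1, 0, 0, 1`. -/
abbrev squareCube {C : Type 1} [Category.{1} C] [Preadditive C] (obj : Bool × Bool → C)
    (edge : ∀ v w, obj v ⟶ obj w)
    (h1 : ∀ v w : Bool × Bool, bit v.1 + bit v.2 - 1 + 1 ≠ bit w.1 + bit w.2 - 1 → edge v w = 0)
    (h2 : ∀ v w, ∑ u, edge v u ≫ edge u w = 0) : CubeData C :=
  ⟨Bool × Bool, inferInstance, fun v => bit v.1 + bit v.2 - 1, obj, edge, h1, h2⟩

/-- An object as a complex in degree zero. -/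
abbrev pointCube {C : Type 1} [Category.{1} C] [Preadditive C] (X : C) : CubeData C :=
  ⟨Unit, inferInstance, fun _ => 0, fun _ => X, fun _ _ => 0, fun _ _ _ => rfl, by simp⟩

section

variable {n : ℕ} {obj : Bool × Bool → Cob n} {X : Cob n}

/-- A morphism out of the two middle vertices of a square, extended by zero. -/
def fromMiddle (f01 : obj (false, true) ⟶ X) (f10 : obj (true, false) ⟶ X) : ∀ v, obj v ⟶ X
  | (false, true) => f01
  | (true, false) => f10
  | (false, false) => 0
  | (true, true) => 0

/-- A morphism into the two middle vertices of a square, extended by zero. -/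
def toMiddle (g01 : X ⟶ obj (false, true)) (g10 : X ⟶ obj (true, false)) : ∀ v, X ⟶ obj v
  | (false, true) => g01
  | (true, false) => g10
  | (false, false) => 0
  | (true, true) => 0

/-- A matrix on a square which lowers the degree by one. -/
def squareHomotopy (a01 : obj (false, true) ⟶ obj (false, false))
    (a10 : obj (true, false) ⟶ obj (false, false)) (b01 : obj (true, true) ⟶ obj (false, true))
    (b10 : obj (true, true) ⟶ obj (true, false)) : ∀ v w, obj v ⟶ obj w
  | (false, true), (false, false) => a01
  | (true, false), (false, false) => a10
  | (true, true), (false, true) => b01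
  | (true, true), (true, false) => b10
  | (false, false), _ => 0
  | _, (true, true) => 0
  | (false, true), (false, true) => 0
  | (false, true), (true, false) => 0
  | (true, false), (false, true) => 0
  | (true, false), (true, false) => 0
  | (true, true), (false, false) => 0

theorem fromMiddle_homogeneous {d : ℤ} {f01 : obj (false, true) ⟶ X} {f10 : obj (true, false) ⟶ X}
    (h01 : Cob.IsHomogeneous d f01) (h10 : Cob.IsHomogeneous d f10) (v) :
    Cob.IsHomogeneous d (fromMiddle f01 f10 v) := by
  obtain ⟨_ | _, _ | _⟩ := v
  exacts [.zero, h01, h10, .zero]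

theorem toMiddle_homogeneous {d : ℤ} {g01 : X ⟶ obj (false, true)} {g10 : X ⟶ obj (true, false)}
    (h01 : Cob.IsHomogeneous d g01) (h10 : Cob.IsHomogeneous d g10) (v) :
    Cob.IsHomogeneous d (toMiddle g01 g10 v) := by
  obtain ⟨_ | _, _ | _⟩ := v
  exacts [.zero, h01, h10, .zero]

theorem squareHomotopy_homogeneous {d : ℤ} {a01 : obj (false, true) ⟶ obj (false, false)}
    {a10 : obj (true, false) ⟶ obj (false, false)} {b01 : obj (true, true) ⟶ obj (false, true)}
    {b10 : obj (true, true) ⟶ obj (true, false)} (h1 : Cob.IsHomogeneous d a01)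
    (h2 : Cob.IsHomogeneous d a10) (h3 : Cob.IsHomogeneous d b01) (h4 : Cob.IsHomogeneous d b10)
    (v w) : Cob.IsHomogeneous d (squareHomotopy a01 a10 b01 b10 v w) := by
  obtain ⟨_ | _, _ | _⟩ := v <;> obtain ⟨_ | _, _ | _⟩ := w <;>
    first | exact .zero | assumption

theorem sum_square {M : Type 1} [AddCommMonoid M] (F : Bool × Bool → M) :
    ∑ u, F u = F (true, true) + F (true, false) + (F (false, true) + F (false, false)) := by
  rw [Fintype.sum_prod_type, Fintype.sum_bool, Fintype.sum_bool, Fintype.sum_bool]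

variable {edge : ∀ v w, obj v ⟶ obj w}
  {h1 : ∀ v w : Bool × Bool, bit v.1 + bit v.2 - 1 + 1 ≠ bit w.1 + bit w.2 - 1 → edge v w = 0}
  {h2 : ∀ v w, ∑ u, edge v u ≫ edge u w = 0}

/-- A square is homotopy equivalent to an object, through maps and homotopies of degree zero, if the
listed identities hold. -/
theorem exists_square_homotopyEquiv
    (f01 : obj (false, true) ⟶ X) (f10 : obj (true, false) ⟶ X)
    (g01 : X ⟶ obj (false, true)) (g10 : X ⟶ obj (true, false))
    (a01 : obj (false, true) ⟶ obj (false, false)) (a10 : obj (true, false) ⟶ obj (false, false))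
    (b01 : obj (true, true) ⟶ obj (false, true)) (b10 : obj (true, true) ⟶ obj (true, false))
    (hf01 : Cob.IsHomogeneous 0 f01) (hf10 : Cob.IsHomogeneous 0 f10)
    (hg01 : Cob.IsHomogeneous 0 g01) (hg10 : Cob.IsHomogeneous 0 g10)
    (ha01 : Cob.IsHomogeneous 0 a01) (ha10 : Cob.IsHomogeneous 0 a10)
    (hb01 : Cob.IsHomogeneous 0 b01) (hb10 : Cob.IsHomogeneous 0 b10)
    (hF : edge (false, false) (false, true) ≫ f01 + edge (false, false) (true, false) ≫ f10 = 0)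
    (hG : g01 ≫ edge (false, true) (true, true) + g10 ≫ edge (true, false) (true, true) = 0)
    (hX : g01 ≫ f01 + g10 ≫ f10 = 𝟙 X)
    (h00 : edge (false, false) (false, true) ≫ a01 + edge (false, false) (true, false) ≫ a10 = -𝟙 _)
    (h11 : b01 ≫ edge (false, true) (true, true) + b10 ≫ edge (true, false) (true, true) = -𝟙 _)
    (m1 : f01 ≫ g01 = edge (false, true) (true, true) ≫ b01
      + a01 ≫ edge (false, false) (false, true) + 𝟙 _)
    (m2 : f01 ≫ g10 = edge (false, true) (true, true) ≫ b10
      + a01 ≫ edge (false, false) (true, false))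
    (m3 : f10 ≫ g01 = edge (true, false) (true, true) ≫ b01
      + a10 ≫ edge (false, false) (false, true))
    (m4 : f10 ≫ g10 = edge (true, false) (true, true) ≫ b10
      + a10 ≫ edge (false, false) (true, false) + 𝟙 _) :
    ∃ F : HomotopyEquiv (squareCube obj edge h1 h2).complex (pointCube X).complex,
      IsGradedEquiv F ∧ ∀ i v w, F.hom.f i v w = fromMiddle f01 f10 v.1 := by
  let K := squareCube obj edge h1 h2
  let L := pointCube X
  have z : ∀ v w : Bool × Bool, bit v.1 + bit v.2 - 1 + 1 ≠ bit w.1 + bit w.2 - 1 → edge v w = 0 := h1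
  have zf : ∀ v w, K.wt v ≠ L.wt w → fromMiddle f01 f10 v = 0 := by
    rintro ⟨_ | _, _ | _⟩ w h <;> first | rfl | exact absurd rfl h
  have zg : ∀ w v, L.wt w ≠ K.wt v → toMiddle g01 g10 v = 0 := by
    rintro w ⟨_ | _, _ | _⟩ h <;> first | rfl | exact absurd rfl h
  let f : K.complex ⟶ L.complex := K.matrixMap L (fun v _ => fromMiddle f01 f10 v) zf (by
    intro v w
    refine (Finset.sum_eq_zero fun _ _ => Limits.comp_zero).trans
      ((sum_square fun u => edge v u ≫ fromMiddle f01 f10 u).trans ?_).symm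
    simp only [fromMiddle, Limits.comp_zero, zero_add, add_zero]
    obtain ⟨_ | _, _ | _⟩ := v
    · rw [add_comm, hF]
    all_goals
      rw [z _ (true, false) (by simp [bit]), z _ (false, true) (by simp [bit]),
        Limits.zero_comp, Limits.zero_comp, add_zero])
  let g : L.complex ⟶ K.complex := L.matrixMap K (fun _ v => toMiddle g01 g10 v) zg (by
    intro w v
    refine ((sum_square fun u => toMiddle g01 g10 u ≫ edge u v).trans ?_).trans
      (Finset.sum_eq_zero fun _ _ => Limits.zero_comp).symm
    simp only [toMiddle, Limits.zero_comp, zero_add, add_zero]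
    obtain ⟨_ | _, _ | _⟩ := v
    case true.true => rw [add_comm, hG]
    all_goals
      rw [z (true, false) _ (by simp [bit]), z (false, true) _ (by simp [bit]),
        Limits.comp_zero, Limits.comp_zero, add_zero])
  let h := squareHomotopy a01 a10 b01 b10
  have hfg : ∀ i v w, (f ≫ g).f i v w = fromMiddle f01 f10 v.1 ≫ toMiddle g01 g10 w.1 := by
    intro i v w
    refine (CubeData.comp_apply f g (fun v _ => fromMiddle f01 f10 v)
      (fun _ v => toMiddle g01 g10 v) (fun _ _ _ => rfl) (fun _ _ _ => rfl) zf i v w).trans ?_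
    exact Fintype.sum_unique _
  have hgf : g ≫ f = 𝟙 _ := by
    refine HomologicalComplex.hom_ext _ _ fun i => Mat_.hom_ext _ _ fun v w => ?_
    refine (CubeData.comp_apply g f (fun _ v => toMiddle g01 g10 v)
      (fun v _ => fromMiddle f01 f10 v) (fun _ _ _ => rfl) (fun _ _ _ => rfl) zg i v w).trans ?_
    refine (sum_square fun u => toMiddle g01 g10 u ≫ fromMiddle f01 f10 u).trans ?_
    refine Eq.trans ?_ (CubeData.id_apply i v w).symm
    refine Eq.trans ?_ (L.diagonal_self (fun _ => 𝟙 _) ()).symm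
    simp only [toMiddle, fromMiddle, Limits.zero_comp, zero_add, add_zero]
    rw [add_comm, hX]
  have key : ∀ D : ∀ v w, obj v ⟶ obj w, (∀ v, D v v = 𝟙 (obj v)) → (∀ v w, v ≠ w → D v w = 0) →
      ∀ v w : Bool × Bool, bit v.1 + bit v.2 - 1 = bit w.1 + bit w.2 - 1 →
      fromMiddle f01 f10 v ≫ toMiddle g01 g10 w
        = ∑ u, edge v u ≫ h u w + ∑ u, h v u ≫ edge u w + D v w := by
    intro D hd hn v w hvw
    rw [sum_square, sum_square]
    obtain ⟨_ | _, _ | _⟩ := v <;> obtain ⟨_ | _, _ | _⟩ := w <;>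
      first
      | (exfalso; revert hvw; decide)
      | simp only [h, squareHomotopy, fromMiddle, toMiddle, hd, Limits.comp_zero,
          Limits.zero_comp, zero_add, add_zero, m1, m2, m3, m4,
          hn _ _ (show ((false, true) : Bool × Bool) ≠ (true, false) by decide),
          hn _ _ (show ((true, false) : Bool × Bool) ≠ (false, true) by decide)]
    · rw [add_comm (_ ≫ a10), h00, neg_add_cancel]
    · rw [add_comm (b10 ≫ _), h11, neg_add_cancel]
  let H : Homotopy (f ≫ g) (𝟙 K.complex) := CubeData.matrixHomotopy
    (fun v w => fromMiddle f01 f10 v ≫ toMiddle g01 g10 w) (K.diagonal fun _ => 𝟙 _) h hfg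
    (CubeData.id_apply (K := K)) (by
      rintro ⟨_ | _, _ | _⟩ ⟨_ | _, _ | _⟩ hvw <;> first | rfl | exact absurd rfl hvw)
    (key _ (K.diagonal_self _) fun _ _ => K.diagonal_ne _)
  refine ⟨⟨f, g, H, Homotopy.ofEq hgf⟩, ⟨?_, ?_, ?_, ?_⟩, fun _ _ _ => rfl⟩
  · exact fun i v w => fromMiddle_homogeneous hf01 hf10 v.1
  · exact fun i v w => toMiddle_homogeneous hg01 hg10 w.1
  · exact fun i j v w => squareHomotopy_homogeneous ha01 ha10 hb01 hb10 v.1 w.1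
  · exact fun i j v w => Cob.IsHomogeneous.zero

/-- A criterion for a diagonal endomorphism of a square to correspond to the negative of an endomorphism
of an object, under a map which vanishes at the outer vertices. -/
theorem square_dot_homotopic {d : ℤ}
    (F : (squareCube obj edge h1 h2).complex ⟶ (pointCube X).complex)
    (f01 : obj (false, true) ⟶ X) (f10 : obj (true, false) ⟶ X)
    (hF : ∀ i v w, F.f i v w = fromMiddle f01 f10 v.1) (φ : ∀ v, obj v ⟶ obj v) (hφ)
    (ψ : X ⟶ X) (hψ) (l : obj (true, true) ⟶ X) (hl : Cob.IsHomogeneous d l)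
    (e01 : edge (false, true) (true, true) ≫ l = φ (false, true) ≫ f01 + f01 ≫ ψ)
    (e10 : edge (true, false) (true, true) ≫ l = φ (true, false) ≫ f10 + f10 ≫ ψ) :
    HomotopicInDegree d ((squareCube obj edge h1 h2).diagonalMap φ hφ ≫ F)
      (F ≫ (-(pointCube X).diagonalMap (fun _ => ψ) hψ)) := by
  let K := squareCube obj edge h1 h2
  let L := pointCube X
  let h : ∀ v, obj v ⟶ X
    | (true, true) => l
    | (true, false) => 0
    | (false, true) => 0
    | (false, false) => 0
  have zf : ∀ v w, K.wt v ≠ L.wt w → fromMiddle f01 f10 v = 0 := by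
    rintro ⟨_ | _, _ | _⟩ w h <;> first | rfl | exact absurd rfl h
  refine ⟨CubeData.matrixHomotopy (fun v _ => φ v ≫ fromMiddle f01 f10 v)
    (fun v _ => -(fromMiddle f01 f10 v ≫ ψ)) (fun v _ => h v) ?_ ?_ ?_ ?_, ?_⟩
  · intro i v w
    refine (CubeData.comp_apply _ F (fun v w => K.diagonal φ v w) (fun v _ => fromMiddle f01 f10 v)
      (fun _ _ _ => rfl) hF (fun v w hvw => K.diagonal_ne φ fun e => hvw (by rw [e])) i v w).trans ?_
    refine (Finset.sum_eq_single v.1 (fun u _ hu => ?_) fun hv => absurd (Finset.mem_univ _) hv).trans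
      ?_
    · rw [K.diagonal_ne φ hu.symm, Limits.zero_comp]
      rfl
    · rw [K.diagonal_self]
  · intro i v w
    refine (CubeData.comp_apply F _ (fun v _ => fromMiddle f01 f10 v)
      (fun v w => -L.diagonal (fun _ => ψ) v w) hF (fun _ _ _ => rfl) zf i v w).trans ?_
    refine (Fintype.sum_unique _).trans ?_
    exact (congrArg _ (congrArg Neg.neg (L.diagonal_self _ _))).trans (Preadditive.comp_neg _ _)
  · rintro ⟨_ | _, _ | _⟩ w hvw <;> first | rfl | exact absurd rfl hvw
  · intro v w hvw
    refine Eq.trans ?_ (congrArg (· + _) (congrArg₂ (· + ·)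
        (sum_square fun u => edge v u ≫ h u).symm
        (Finset.sum_eq_zero fun _ _ => Limits.comp_zero).symm))
    obtain ⟨_ | _, _ | _⟩ := v
    · exact absurd hvw (by simp [bit])
    · simp only [h, fromMiddle, Limits.comp_zero, add_zero, e01]
      rw [add_neg_cancel_right]
    · simp only [h, fromMiddle, Limits.comp_zero, add_zero, e10]
      rw [add_neg_cancel_right]
    · exact absurd hvw (by simp [bit])
  · rintro i j ⟨⟨_ | _, _ | _⟩, hv⟩ w
    exacts [.zero, .zero, .zero, hl]

end

/-! ### Simplification of the square of the second Reidemeister move -/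

section

variable {n : ℕ} {obj : Bool × Bool → Cob n} {X : Cob n} {edge : ∀ v w, obj v ⟶ obj w}
  {h1 : ∀ v w : Bool × Bool, bit v.1 + bit v.2 - 1 + 1 ≠ bit w.1 + bit w.2 - 1 → edge v w = 0}
  {h2 : ∀ v w, ∑ u, edge v u ≫ edge u w = 0}

/-- Cancellation in a square whose vertex `(true, false)` contains a circle with birth `β` and death
`κ`: the complex is equivalent to the vertex `(false, true)`, which `ι` identifies with `X`. If `ρ` is the
reversed saddle and its composites with the differential are sums of two dots, then the equivalence turns the
dot `φ` of the square into the dot `-ψ`, where `ζ` is the dot `ψ` on the vertex `(false, true)`. -/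
theorem exists_equiv_of_circle_right
    {σ : obj (false, false) ⟶ obj (false, true)} {δ : obj (false, false) ⟶ obj (true, false)}
    {τ : obj (false, true) ⟶ obj (true, true)} {μ : obj (true, false) ⟶ obj (true, true)}
    {κ : obj (true, false) ⟶ obj (false, false)} {β : obj (true, true) ⟶ obj (true, false)}
    {ι : obj (false, true) ⟶ X} {ι' : X ⟶ obj (false, true)}
    (eσ : edge (false, false) (false, true) = σ) (eδ : edge (false, false) (true, false) = δ)
    (eτ : edge (false, true) (true, true) = τ) (eμ : edge (true, false) (true, true) = -μ)
    (hκ : Cob.IsHomogeneous 0 κ) (hβ : Cob.IsHomogeneous 0 β) (hι : Cob.IsHomogeneous 0 ι)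
    (hι' : Cob.IsHomogeneous 0 ι') (hf : Cob.IsHomogeneous 0 ((κ ≫ σ) ≫ ι))
    (hg : Cob.IsHomogeneous 0 (ι' ≫ τ ≫ β))
    (r1 : δ ≫ κ = 𝟙 _) (r2 : β ≫ μ = 𝟙 _) (r3 : β ≫ κ = 0)
    (r4 : 𝟙 _ + (κ ≫ σ) ≫ τ ≫ β = κ ≫ δ + μ ≫ β) (r5 : ι ≫ ι' = 𝟙 _) (r6 : ι' ≫ ι = 𝟙 _) :
    ∃ F : HomotopyEquiv (squareCube obj edge h1 h2).complex (pointCube X).complex,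
      IsGradedEquiv F ∧ ∀ (d : ℤ) (φ : ∀ v, obj v ⟶ obj v) (hφ) (ψ : X ⟶ X) (hψ)
        (ρ : obj (true, true) ⟶ obj (false, true)) (ζ : obj (false, true) ⟶ obj (false, true)),
        Cob.IsHomogeneous d (ρ ≫ ι) → ζ ≫ ι = ι ≫ ψ → τ ≫ ρ = ζ + φ (false, true) →
        μ ≫ ρ = (κ ≫ σ) ≫ ζ + φ (true, false) ≫ κ ≫ σ →
        HomotopicInDegree d ((squareCube obj edge h1 h2).diagonalMap φ hφ ≫ F.hom)
          (F.hom ≫ (-(pointCube X).diagonalMap (fun _ => ψ) hψ)) := by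
  obtain ⟨F, hF, hFe⟩ := exists_square_homotopyEquiv (edge := edge) (h1 := h1) (h2 := h2)
    -- The two nonzero entries `-κ`, `β` of the homotopy are dictated by `δ ≫ κ = 𝟙`, `β ≫ μ = 𝟙`.
    ι (-((κ ≫ σ) ≫ ι)) ι' (ι' ≫ τ ≫ β) 0 (-κ) 0 β hι hf.neg hι' hg .zero hκ.neg .zero hβ
    (by rw [eσ, eδ, Preadditive.comp_neg, Category.assoc, reassoc_of% r1, add_neg_cancel])
    (by rw [eτ, eμ, Preadditive.comp_neg, Category.assoc, Category.assoc, r2, Category.comp_id,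
      add_neg_cancel])
    (by
      rw [Preadditive.comp_neg]
      simp only [Category.assoc, r6]
      rw [reassoc_of% r3]
      simp)
    (by rw [eδ, Limits.comp_zero, zero_add, Preadditive.comp_neg, r1])
    (by rw [eμ, Limits.zero_comp, zero_add, Preadditive.comp_neg, r2])
    (by rw [Limits.comp_zero, Limits.zero_comp, zero_add, zero_add, r5])
    (by rw [eτ, Limits.zero_comp, add_zero, reassoc_of% r5])
    (by rw [eσ, Limits.comp_zero, zero_add, Preadditive.neg_comp, Category.assoc, r5,
      Category.comp_id, Preadditive.neg_comp])
    (by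
      rw [eμ, eδ, Preadditive.neg_comp, Preadditive.neg_comp, Preadditive.neg_comp, Category.assoc,
        reassoc_of% r5, ← neg_add, add_comm (μ ≫ β), ← r4, neg_add_rev, neg_add_cancel_right])
  refine ⟨F, hF, fun d φ hφ ψ hψ ρ ζ hl hζ s1 s2 => ?_⟩
  refine square_dot_homotopic F.hom ι (-((κ ≫ σ) ≫ ι)) hFe φ hφ ψ hψ (ρ ≫ ι) hl ?_ ?_
  · rw [eτ, reassoc_of% s1, Preadditive.add_comp, hζ, add_comm]
  · rw [eμ, Preadditive.neg_comp, reassoc_of% s2, Preadditive.add_comp]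
    simp only [Category.assoc, hζ, Preadditive.comp_neg, Preadditive.neg_comp]
    rw [neg_add_rev]

/-- The analogue of `exists_equiv_of_circle_right` in which the circle is at the vertex `(false, true)`;
the sign of the square is then on the other edge. -/
theorem exists_equiv_of_circle_left
    {σ : obj (false, false) ⟶ obj (true, false)} {δ : obj (false, false) ⟶ obj (false, true)}
    {τ : obj (true, false) ⟶ obj (true, true)} {μ : obj (false, true) ⟶ obj (true, true)}
    {κ : obj (false, true) ⟶ obj (false, false)} {β : obj (true, true) ⟶ obj (false, true)}
    {ι : obj (true, false) ⟶ X} {ι' : X ⟶ obj (true, false)}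
    (eσ : edge (false, false) (true, false) = σ) (eδ : edge (false, false) (false, true) = δ)
    (eτ : edge (true, false) (true, true) = -τ) (eμ : edge (false, true) (true, true) = μ)
    (hκ : Cob.IsHomogeneous 0 κ) (hβ : Cob.IsHomogeneous 0 β) (hι : Cob.IsHomogeneous 0 ι)
    (hι' : Cob.IsHomogeneous 0 ι') (hf : Cob.IsHomogeneous 0 ((κ ≫ σ) ≫ ι))
    (hg : Cob.IsHomogeneous 0 (ι' ≫ τ ≫ β))
    (r1 : δ ≫ κ = 𝟙 _) (r2 : β ≫ μ = 𝟙 _) (r3 : β ≫ κ = 0)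
    (r4 : 𝟙 _ + (κ ≫ σ) ≫ τ ≫ β = κ ≫ δ + μ ≫ β) (r5 : ι ≫ ι' = 𝟙 _) (r6 : ι' ≫ ι = 𝟙 _) :
    ∃ F : HomotopyEquiv (squareCube obj edge h1 h2).complex (pointCube X).complex,
      IsGradedEquiv F ∧ ∀ (d : ℤ) (φ : ∀ v, obj v ⟶ obj v) (hφ) (ψ : X ⟶ X) (hψ)
        (ρ : obj (true, true) ⟶ obj (true, false)) (ζ : obj (true, false) ⟶ obj (true, false)),
        Cob.IsHomogeneous d (ρ ≫ ι) → ζ ≫ ι = ι ≫ ψ → τ ≫ ρ = ζ + φ (true, false) →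
        μ ≫ ρ = (κ ≫ σ) ≫ ζ + φ (false, true) ≫ κ ≫ σ →
        HomotopicInDegree d ((squareCube obj edge h1 h2).diagonalMap φ hφ ≫ F.hom)
          (F.hom ≫ (-(pointCube X).diagonalMap (fun _ => ψ) hψ)) := by
  obtain ⟨F, hF, hFe⟩ := exists_square_homotopyEquiv (edge := edge) (h1 := h1) (h2 := h2)
    (-((κ ≫ σ) ≫ ι)) ι (ι' ≫ τ ≫ β) ι' (-κ) 0 (-β) 0 hf.neg hι hg hι' hκ.neg .zero hβ.neg .zero
    (by rw [eσ, eδ, Preadditive.comp_neg, Category.assoc, reassoc_of% r1, neg_add_cancel])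
    (by rw [eτ, eμ, Preadditive.comp_neg, Category.assoc, Category.assoc, r2, Category.comp_id,
      add_neg_cancel])
    (by
      rw [Preadditive.comp_neg]
      simp only [Category.assoc, r6]
      rw [reassoc_of% r3]
      simp)
    (by rw [eδ, Limits.comp_zero, add_zero, Preadditive.comp_neg, r1])
    (by rw [eμ, Limits.zero_comp, add_zero, Preadditive.neg_comp, r2])
    (by
      rw [eμ, eδ, Preadditive.comp_neg, Preadditive.neg_comp, Preadditive.neg_comp, Category.assoc,
        reassoc_of% r5, ← neg_add, add_comm (μ ≫ β), ← r4, neg_add_rev, neg_add_cancel_right])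
    (by rw [eσ, Limits.comp_zero, zero_add, Preadditive.neg_comp, Category.assoc, r5,
      Category.comp_id, Preadditive.neg_comp])
    (by rw [eτ, Limits.zero_comp, add_zero, reassoc_of% r5, Preadditive.comp_neg,
      Preadditive.neg_comp, neg_neg])
    (by rw [Limits.comp_zero, Limits.zero_comp, zero_add, zero_add, r5])
  refine ⟨F, hF, fun d φ hφ ψ hψ ρ ζ hl hζ s1 s2 => ?_⟩
  refine square_dot_homotopic F.hom (-((κ ≫ σ) ≫ ι)) ι hFe φ hφ ψ hψ (-(ρ ≫ ι)) hl.neg ?_ ?_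
  · rw [eμ, Preadditive.comp_neg, reassoc_of% s2, Preadditive.add_comp]
    simp only [Category.assoc, hζ, Preadditive.comp_neg, Preadditive.neg_comp]
    rw [neg_add_rev]
  · rw [eτ, Preadditive.comp_neg, Preadditive.neg_comp, neg_neg, reassoc_of% s1,
      Preadditive.add_comp, hζ, add_comm]

end

/-- The degree of a composite, computed from a table for the stack of the two surfaces. -/
theorem isHomogeneous_comp_tab {n : ℕ} {A B C : Diag n} {q q' q'' : ℤ} {S : Surf A B} {T : Surf B C}
    (hS : isCobordism n S.cls) (hT : isCobordism n T.cls) {m : ℕ} {b t} {w} {c : Fin m → ℤ} {e}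
    (h : Equivalent (stack S T) (tab b t w c e)) {d : ℤ}
    (hd : d = (∑ i, c i) - 2 * (∑ i, (e i : ℤ)) - n + q'' - q) :
    Cob.IsHomogeneous d (Cob.mkSurf q q' S hS ≫ Cob.mkSurf q' q'' T hT) := by
  rw [Cob.mkSurf_comp hS hT (isCobordism_stack hS hT h) h]
  exact Cob.isHomogeneous_tab _ _ _ hd

theorem death_homogeneous (i : Fin 2) (q q' : ℤ) :
    Cob.IsHomogeneous (q' - q + 1) (deathHom i q q') :=
  Cob.isHomogeneous_tab _ _ _ (by simp; ring)

theorem birth_homogeneous (i : Fin 2) (q q' : ℤ) :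
    Cob.IsHomogeneous (q' - q + 1) (birthHom i q q') :=
  Cob.isHomogeneous_tab _ _ _ (by simp; ring)

theorem forget_homogeneous (q q' : ℤ) : Cob.IsHomogeneous (q' - q) (forgetHom q q') :=
  Cob.isHomogeneous_tab _ _ _ (by simp)

theorem unforget_homogeneous (q q' : ℤ) : Cob.IsHomogeneous (q' - q) (unforgetHom q q') :=
  Cob.isHomogeneous_tab _ _ _ (by simp)

theorem up_forget_homogeneous (i : Fin 2) (q r q' : ℤ) :
    Cob.IsHomogeneous (q' - q - 1) (upHom i q r ≫ forgetHom r q') :=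
  isHomogeneous_comp_tab _ _ (stack_tab (m₁ := 1) (m₂ := 2) (m₃ := 1) (b₃ := ![0, 0]) (t₃ := ![0, 0])
    (w₃ := by decide +revert) (c₃ := 1) (d₃ := 0) (![0] : Fin 1 → Fin 1) (![0, 0] : Fin 2 → Fin 1)
    (by decide +revert) (by decide +revert) (by decide +revert) (by decide +revert)
    (by decide +revert) (by decide +revert) (by decide +revert) (by decide +revert))
    (by simp; ring)

theorem death_up_forget_homogeneous (i : Fin 2) (q p r q' : ℤ) :
    Cob.IsHomogeneous (q' - q) ((deathHom i q p ≫ upHom i p r) ≫ forgetHom r q') := by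
  rw [death_comp_up]
  exact isHomogeneous_comp_tab _ _ (stack_tab (m₁ := 2) (m₂ := 2) (m₃ := 2) (b₃ := ![0, 0, 1])
    (t₃ := ![0, 0]) (w₃ := by decide) (c₃ := 1) (d₃ := 0)
    (![0, 1] : Fin 2 → Fin 2) (![0, 0] : Fin 2 → Fin 2)
    (by decide) (by decide) (by decide) (by decide) (by decide) (by decide) (by decide) (by decide))
    (by simp)

theorem unforget_down_birth_homogeneous (i : Fin 2) (q p r q' : ℤ) :
    Cob.IsHomogeneous (q' - q) (unforgetHom q p ≫ downHom i p r ≫ birthHom i r q') := by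
  rw [down_comp_birth]
  exact isHomogeneous_comp_tab _ _ (stack_tab (m₁ := 2) (m₂ := 2) (m₃ := 2) (b₃ := ![0, 0])
    (t₃ := ![0, 0, 1]) (w₃ := by decide) (c₃ := 1) (d₃ := 0)
    (![0, 0] : Fin 2 → Fin 2) (![0, 1] : Fin 2 → Fin 2)
    (by decide) (by decide) (by decide) (by decide) (by decide) (by decide) (by decide) (by decide))
    (by simp)

theorem HomotopicInDegree.zsmul_comp {n : ℕ} {K L : Kom n} {d : ℤ} {D : K ⟶ K} {S : L ⟶ L}
    {F : K ⟶ L} (h : HomotopicInDegree d (D ≫ F) (F ≫ (-S))) (m : ℤ) :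
    HomotopicInDegree d ((m • D) ≫ F) (F ≫ (-m • S)) := by
  have := h.zsmul m
  rwa [← Preadditive.zsmul_comp, ← Preadditive.comp_zsmul, smul_neg, ← neg_smul] at this

theorem reidemeister_vert : ∃ F : HomotopyEquiv (reidemeister .vert).complex strands.complex,
    IsGradedEquiv F ∧
      HomotopicInDegree (-2) (reidemeisterDot .vert 5 ≫ F.hom) (F.hom ≫ (-strandsDot 0)) ∧
      HomotopicInDegree (-2) (reidemeisterDot .vert 4 ≫ F.hom) (F.hom ≫ (-strandsDot 1)) := by
  obtain ⟨F, hF, hd⟩ := exists_equiv_of_circle_right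
    (obj := fun v => Cob.of (reidemeisterObj .vert v)) (X := Cob.of (straight.shift 0))
    (edge := reidemeisterEdge .vert)
    (h1 := (reidemeister .vert).edge_wt) (h2 := reidemeister_edge_sq .vert)
    (σ := upHom 0 _ _) (δ := splitHom 0 _ _) (τ := downHom 1 _ _) (μ := mergeHom 1 _ _)
    (κ := deathHom 0 _ _) (β := birthHom 1 _ _) (ι := forgetHom _ _) (ι' := unforgetHom _ _)
    (saddleCob_eq_up 0 _ _ _ (twoCrossings_genuine_right .vert .horiz))
    (saddleCob_eq_split 0 _ _ (twoCrossings_genuine_left .vert .horiz))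
    (saddleCob_eq_down 1 _ _ _ (twoCrossings_genuine_left .vert .vert))
    (congrArg Neg.neg (saddleCob_eq_merge 1 _ _ (twoCrossings_genuine_right .horiz .horiz)))
    (death_homogeneous 0 _ _) (birth_homogeneous 1 _ _) (forget_homogeneous _ _)
    (unforget_homogeneous _ _) (death_up_forget_homogeneous 0 _ _ _ _)
    (unforget_down_birth_homogeneous 1 _ _ _ _)
    (split_comp_death 0 _ _) (birth_comp_merge 1 _ _) (birth_comp_death 0 1 _ _ _)
    (circle_relation 0 1 _ _ _ (by decide) _) (forget_comp_unforget _ _) (unforget_comp_forget _ _)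
  refine ⟨F, hF, ?_, ?_⟩
  · exact hd (-2) _ (reidemeister_dot_comm .vert 5) _ _ (upHom 1 _ _) (Cob.dotHom vertical _ 0)
      (up_forget_homogeneous 1 _ _ _) (dot_comp_forget _ _ 0 0 rfl)
      (down_comp_up 1 _ _ 5 0 rfl rfl) (merge_comp_up 0 1 _ _ _ _ 5 0 rfl)
  · exact hd (-2) _ (reidemeister_dot_comm .vert 4) _ _ (upHom 1 _ _) (Cob.dotHom vertical _ 1)
      (up_forget_homogeneous 1 _ _ _) (dot_comp_forget _ _ 1 1 rfl)
      ((down_comp_up 1 _ _ 1 4 rfl rfl).trans (add_comm _ _)) (merge_comp_up 0 1 _ _ _ _ 4 1 rfl)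

theorem reidemeister_horiz : ∃ F : HomotopyEquiv (reidemeister .horiz).complex strands.complex,
    IsGradedEquiv F ∧
      HomotopicInDegree (-2) (reidemeisterDot .horiz 5 ≫ F.hom) (F.hom ≫ (-strandsDot 0)) ∧
      HomotopicInDegree (-2) (reidemeisterDot .horiz 4 ≫ F.hom) (F.hom ≫ (-strandsDot 1)) := by
  obtain ⟨F, hF, hd⟩ := exists_equiv_of_circle_left
    (obj := fun v => Cob.of (reidemeisterObj .horiz v)) (X := Cob.of (straight.shift 0))
    (edge := reidemeisterEdge .horiz)
    (h1 := (reidemeister .horiz).edge_wt) (h2 := reidemeister_edge_sq .horiz)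
    (σ := upHom 1 _ _) (δ := splitHom 1 _ _) (τ := downHom 0 _ _) (μ := mergeHom 0 _ _)
    (κ := deathHom 1 _ _) (β := birthHom 0 _ _) (ι := forgetHom _ _) (ι' := unforgetHom _ _)
    (saddleCob_eq_up 1 _ _ _ (twoCrossings_genuine_left .horiz .vert))
    (saddleCob_eq_split 1 _ _ (twoCrossings_genuine_right .horiz .vert))
    (congrArg Neg.neg (saddleCob_eq_down 0 _ _ _ (twoCrossings_genuine_right .vert .vert)))
    (saddleCob_eq_merge 0 _ _ (twoCrossings_genuine_left .horiz .horiz))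
    (death_homogeneous 1 _ _) (birth_homogeneous 0 _ _) (forget_homogeneous _ _)
    (unforget_homogeneous _ _) (death_up_forget_homogeneous 1 _ _ _ _)
    (unforget_down_birth_homogeneous 0 _ _ _ _)
    (split_comp_death 1 _ _) (birth_comp_merge 0 _ _) (birth_comp_death 1 0 _ _ _)
    (circle_relation 1 0 _ _ _ (by decide) _) (forget_comp_unforget _ _) (unforget_comp_forget _ _)
  refine ⟨F, hF, ?_, ?_⟩
  · exact hd (-2) _ (reidemeister_dot_comm .horiz 5) _ _ (upHom 0 _ _) (Cob.dotHom vertical _ 0)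
      (up_forget_homogeneous 0 _ _ _) (dot_comp_forget _ _ 0 0 rfl)
      (down_comp_up 0 _ _ 5 0 rfl rfl) (merge_comp_up 1 0 _ _ _ _ 5 0 rfl)
  · exact hd (-2) _ (reidemeister_dot_comm .horiz 4) _ _ (upHom 0 _ _) (Cob.dotHom vertical _ 1)
      (up_forget_homogeneous 0 _ _ _) (dot_comp_forget _ _ 1 1 rfl)
      ((down_comp_up 0 _ _ 1 4 rfl rfl).trans (add_comm _ _)) (merge_comp_up 1 0 _ _ _ _ 4 1 rfl)

end DottedCob

end

open DottedCob

theorem proposition8p3 :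
    (∀ (s : Smoothing) (c : CrossingSign),
      HomotopicInDegree (-2) (crossingDot s c 0) (-crossingDot s c 2) ∧
      HomotopicInDegree (-2) (crossingDot s c 1) (-crossingDot s c 3)) ∧
    ∀ s : Smoothing, ∃ F : HomotopyEquiv (reidemeister s).complex strands.complex,
      IsGradedEquiv F ∧
      ∀ u : ℤˣ,
        HomotopicInDegree (-2) (((u : ℤ) • reidemeisterDot s 5) ≫ F.hom)
          (F.hom ≫ (-(u : ℤ) • strandsDot 0)) ∧
        HomotopicInDegree (-2) (((u : ℤ) • reidemeisterDot s 4) ≫ F.hom)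
          (F.hom ≫ (-(u : ℤ) • strandsDot 1)) := by
  refine ⟨fun s c => ⟨crossingDot_homotopic s c 0 2 ?_, crossingDot_homotopic s c 1 3 ?_⟩,
    fun s => ?_⟩
  · rintro (_ | _)
    · exact show (0 : Fin 2) ≠ 1 by decide
    · exact show (0 : Fin 2) ≠ 1 by decide
  · rintro (_ | _)
    · exact show (1 : Fin 2) ≠ 0 by decide
    · exact show (0 : Fin 2) ≠ 1 by decide
  · obtain ⟨F, hF, h5, h4⟩ : ∃ F : HomotopyEquiv (reidemeister s).complex strands.complex,
        IsGradedEquiv F ∧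
          HomotopicInDegree (-2) (reidemeisterDot s 5 ≫ F.hom) (F.hom ≫ (-strandsDot 0)) ∧
          HomotopicInDegree (-2) (reidemeisterDot s 4 ≫ F.hom) (F.hom ≫ (-strandsDot 1)) := by
      cases s
      · exact reidemeister_vert
      · exact reidemeister_horiz
    exact ⟨F, hF, fun u => ⟨h5.zsmul_comp u, h4.zsmul_comp u⟩⟩
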